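/- Throughout, $\mathcal{L}$ is a first-order language with no relation symbols and at least one constant symbol; algebras are $\mathcal{L}$-structures, equations are atomic formulas $s\approx t$, conjunctions of equations are finite (the empty one is $\top$), and $\mathcal V\models\alpha$ means that $\alpha$ holds in all members of $\mathcal V$ under all assignments. A variety is a class of algebras closed under homomorphic images, subalgebras and (arbitrary) direct products. For a class $\mathcal V$ of algebras: - $\mathcal V$ has the *compact intersection property* if, for each $\mathbf A\in\mathcal V$, the intersection of any two compact (that is, finitely generated) congruences of $\mathbf A$ is compact. - $\mathcal V$ has *equationally definable principal congruences* (EDPC) if there is a conjunction of equations $\alpha(x_1,x_2,y_1,y_2)$ such that for all $\mathbf A\in\mathcal V$ and $a_1,a_2,b_1,b_2\in A$, the pair $(a_1,a_2)$ belongs to the congruence of $\mathbf A$ generated by $(b_1,b_2)$ if and only if $\mathbf A\models\alpha(a_1,a_2,b_1,b_2)$. - $\mathcal V$ is *coherent* if every finitely generated subalgebra of a finitely presented member of $\mathcal V$ is finitely presented (in $\mathcal V$). - $\mathcal V$ has the *amalgamation property* if for all $\mathbf A,\mathbf B,\mathbf C\in\mathcal V$ and embeddings $f\colon\mathbf A\to\mathbf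 B$, $g\colon\mathbf A\to\mathbf C$, there are $\mathbf D\in\mathcal V$ and embeddings $h\colon\mathbf B\to\mathbf D$, $k\colon\mathbf C\to\mathbf D$ with $hf=kg$. - $\mathcal V$ has the *equational variable restriction property* if for any finite set of variables $\overline x,y$ and conjunction of equations $\gamma(\overline x,y)$, there is a formula $\pi(\overline x)$ that is either $\bot$ or a conjunction of equations such that $\mathcal V\models\pi\to\gamma$ and, for every conjunction of equations $\varphi(\overline x)$, if $\mathcal V\models\varphi\to\gamma$, then $\mathcal V\models\varphi\to\pi$. A theory $T^*$ is a *model completion* of a theory $T$ in the same language if $T$ and $T^*$ entail the same universal sentences, every formula is equivalent over $T^*$ to an existential formula, and for every model $M$ of $T$ the theory $T^*$ together with the diagram of $M$ is complete. Let $\mathrm{Th}(\mathcal V)$ be the set of first-order sentences true in all members of $\mathcal V$. **Theorem.** Let $\mathcal V$ be a variety that has the compact intersection property and equationally definable principal congruences. Then $\mathrm{Th}(\mathcal V)$ has a model completion if and only if $\mathcal V$ is coherent and has the amalgamation property and the equational variable restriction property. Moreover, the right-to-left implication holds for every variety with equationally definable principal congruences, even without the compact intersection property. -/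

import Mathlib

open FirstOrder

universe u v w

namespace UnivAlg

open FirstOrder.Language FirstOrder.Language.Structure CategoryTheory

/-! ### Varieties -/

/-- The direct product of a family of structures, with operations computed coordinatewise. -/
@[reducible] def piStructure (L : FirstOrder.Language.{u, v}) {ι : Type w} (A : ι → Bundled.{w} L.Structure) :
    L.Structure (∀ i, A i) where
  funMap f x := fun i => funMap f (fun k => x k i)
  RelMap r x := ∀ i, RelMap r (fun k => x k i)

/-- The direct product as a bundled structure. -/
def piBundled {L : FirstOrder.Language.{u, v}} {ι : Type w} (A : ι → Bundled.{w} L.Structure) :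
    Bundled.{w} L.Structure :=
  ⟨∀ i, A i, piStructure L A⟩

/-- A variety: a class of algebras closed under homomorphic images, subalgebras (up to isomorphism)
and arbitrary direct products, including the empty product. -/
structure IsVariety {L : FirstOrder.Language.{u, v}} (V : Set (Bundled.{w} L.Structure)) : Prop where
  homImage : ∀ A B : Bundled.{w} L.Structure, A ∈ V →
    ∀ f : A →[L] B, Function.Surjective f → B ∈ V
  subalgebra : ∀ A B : Bundled.{w} L.Structure, A ∈ V → Nonempty (B ↪[L] A) → B ∈ V
  product : ∀ (ι : Type w) (A : ι → Bundled.{w} L.Structure), (∀ i, A i ∈ V) → piBundled A ∈ V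

/-! ### Equations and validity -/

/-- The conjunction of a finite list of equations; the empty conjunction is `⊤`. -/
def eqConj {L : FirstOrder.Language.{u, v}} {α : Type*} (E : List (L.Term α × L.Term α)) : L.Formula α :=
  (E.map fun e => e.1.equal e.2).foldr (· ⊓ ·) ⊤

/-- `φ` is a conjunction of equations. -/
def IsEqConj {L : FirstOrder.Language.{u, v}} {α : Type*} (φ : L.Formula α) : Prop :=
  ∃ E : List (L.Term α × L.Term α), φ = eqConj E

/-- The formula `φ` is valid in all members of `V` under all assignments. -/
def Valid {L : FirstOrder.Language.{u, v}} (V : Set (Bundled.{w} L.Structure)) {α : Type*}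
    (φ : L.Formula α) : Prop :=
  ∀ A ∈ V, ∀ a : α → A, φ.Realize a

/-- A formula in the variables `x₁, …, xₙ` seen as a formula in the variables `x₁, …, xₙ, y`,
where `y` is the variable `Fin.last n`. -/
def weaken {L : FirstOrder.Language.{u, v}} {n : ℕ} (φ : L.Formula (Fin n)) : L.Formula (Fin (n + 1)) :=
  φ.relabel Fin.castSucc

/-! ### Congruences -/

/-- An equivalence relation compatible with all operations. -/
def IsCongruence (L : FirstOrder.Language.{u, v}) {A : Type*} [L.Structure A] (r : Setoid A) : Prop :=
  ∀ (n : ℕ) (f : L.Functions n) (x y : Fin n → A),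
    (∀ i, r (x i) (y i)) → r (funMap f x) (funMap f y)

/-- The congruence generated by a set of pairs: the least congruence containing it. -/
def congruenceGen (L : FirstOrder.Language.{u, v}) {A : Type*} [L.Structure A] (S : Set (A × A)) : Setoid A :=
  sInf {r | IsCongruence L r ∧ ∀ p ∈ S, r p.1 p.2}

/-- Compact (equivalently, finitely generated) congruences. -/
def IsCompactCon (L : FirstOrder.Language.{u, v}) {A : Type*} [L.Structure A] (r : Setoid A) : Prop :=
  ∃ S : Set (A × A), S.Finite ∧ r = congruenceGen L S

/-- The intersection of two compact congruences of a member of `V` is compact. -/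
def CompactIntersectionProperty {L : FirstOrder.Language.{u, v}} (V : Set (Bundled.{w} L.Structure)) :
    Prop :=
  ∀ A ∈ V, ∀ r s : Setoid A, IsCompactCon L r → IsCompactCon L s → IsCompactCon L (r ⊓ s)

/-- Equationally definable principal congruences: one conjunction of equations in four variables
defines all principal congruences of all members of `V`. -/
def HasEDPC {L : FirstOrder.Language.{u, v}} (V : Set (Bundled.{w} L.Structure)) : Prop :=
  ∃ φ : L.Formula (Fin 4), IsEqConj φ ∧ ∀ A ∈ V, ∀ a₁ a₂ b₁ b₂ : A,
    congruenceGen L {(b₁, b₂)} a₁ a₂ ↔ φ.Realize ![a₁, a₂, b₁, b₂]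

/-! ### Coherence -/

/-- `A` is finitely presented relative to `V`: it is generated by a finite tuple `a` satisfying a
finite conjunction `φ` of equations, and it is universal among the members of `V` with a tuple
satisfying `φ`. -/
def FinitelyPresented {L : FirstOrder.Language.{u, v}} (V : Set (Bundled.{w} L.Structure))
    (A : Type w) [L.Structure A] : Prop :=
  ∃ (n : ℕ) (φ : L.Formula (Fin n)) (a : Fin n → A), IsEqConj φ ∧
    Substructure.closure L (Set.range a) = ⊤ ∧ φ.Realize a ∧
    ∀ B ∈ V, ∀ b : Fin n → B, φ.Realize b → ∃ f : A →[L] B, ∀ i, f (a i) = b i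

/-- Every finitely generated subalgebra of a finitely presented member of `V` is finitely
presented. -/
def Coherent {L : FirstOrder.Language.{u, v}} (V : Set (Bundled.{w} L.Structure)) : Prop :=
  ∀ A ∈ V, FinitelyPresented V A → ∀ S : L.Substructure A, S.FG → FinitelyPresented V S

/-! ### The equational variable restriction property -/

def EqVarRestriction {L : FirstOrder.Language.{u, v}} (V : Set (Bundled.{w} L.Structure)) : Prop :=
  ∀ (n : ℕ) (γ : L.Formula (Fin (n + 1))), IsEqConj γ →
    ∃ π : L.Formula (Fin n), (π = ⊥ ∨ IsEqConj π) ∧ Valid V ((weaken π).imp γ) ∧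
      ∀ φ : L.Formula (Fin n), IsEqConj φ → Valid V ((weaken φ).imp γ) → Valid V (φ.imp π)

/-! ### Model completions -/

/-- The theory of a class: the sentences true in all its members. -/
def theoryOf {L : FirstOrder.Language.{u, v}} (V : Set (Bundled.{w} L.Structure)) : L.Theory :=
  {φ | ∀ A ∈ V, A ⊨ φ}

/-- Co-theories: theories entailing the same universal sentences. -/
def CoTheory {L : FirstOrder.Language.{u, v}} (T T' : L.Theory) : Prop :=
  ∀ φ : L.Sentence, φ.IsUniversal → (T ⊨ᵇ φ ↔ T' ⊨ᵇ φ)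

/-- Model completeness: every formula is equivalent over `T` to an existential formula. -/
def ModelComplete {L : FirstOrder.Language.{u, v}} (T : L.Theory) : Prop :=
  ∀ (n : ℕ) (φ : L.Formula (Fin n)), ∃ ψ : L.Formula (Fin n),
    ψ.IsExistential ∧ T ⊨ᵇ φ.iff ψ

/-- A model companion of `T` is a model complete co-theory of `T`. -/
def IsModelCompanion {L : FirstOrder.Language.{u, v}} (T T' : L.Theory) : Prop :=
  ModelComplete T' ∧ CoTheory T T'

/-- The diagram of `M`: the atomic sentences and negated atomic sentences, in the language with a
constant for each element of `M`, that hold in `M`. -/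
def diagram (L : FirstOrder.Language.{u, v}) (M : Type w) [L.Structure M] : L[[M]].Theory :=
  {φ | (φ.IsAtomic ∨ ∃ ψ : L[[M]].Sentence, ψ.IsAtomic ∧ φ = ψ.not) ∧ M ⊨ φ}

/-- A model completion of `T` is a model companion `T'` of `T` such that, for every model `M` of
`T`, the theory `T'` together with the diagram of `M` is complete. The models `M` range over the
universe `w`. -/
def IsModelCompletion {L : FirstOrder.Language.{u, v}} (T T' : L.Theory) : Prop :=
  IsModelCompanion T T' ∧ ∀ (M : Type w) [L.Structure M] [Nonempty M], M ⊨ T →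
    ((L.lhomWithConstants M).onTheory T' ∪ diagram L M).IsComplete

def HasModelCompletion {L : FirstOrder.Language.{u, v}} (T : L.Theory) : Prop :=
  ∃ T' : L.Theory, IsModelCompletion.{u, v, w} T T'

end UnivAlg

-- Without relation symbols, an algebra with named generators is determined by the equations that
-- the generators satisfy, and entailment of equations in `V` is compact (`Entails.exists_finite`).
-- EDPC internalizes implication: for finite `G`, `H` there is a finite set `G → H` of equations
-- that holds at a tuple iff every homomorphism into `V` making `G` true there makes `H` true
-- (`HasEDPC.exists_imp`). Hence `Θ ∪ G` entails `e` iff `Θ` entails `G → e`.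
--
-- Sufficiency. Take equations `G(x, y)` and negated equations `¬ e(x, y)`. A tuple `a` admits a
-- solution `y` in some extension iff it satisfies all consequences of `G` in `x` alone, and its
-- equations together with `G` entail no `e`. Coherence makes the first condition a finite set of
-- equations; the variable restriction property, applied to `G → e`, makes the second
-- quantifier-free. A solution lives in the algebra presented by `G` and the equations of `a`; that
-- algebra contains the subalgebra generated by `a` and is amalgamated over it with the given
-- algebra (`exists_solvability_condition`). Every member of `V` embeds into one where all systems
-- meeting their condition are solved (`exists_embedding_solvedClass`). These algebras have
-- quantifier elimination, and their theory is the model completion.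
--
-- Necessity. Let `T` be a model completion. Every member of `V` embeds into a model of `T`, and the
-- truth of a formula at a tuple of such a model depends only on the equations of the tuple
-- (`IsModelCompletion.transfer`). Amalgamation follows by moving finite parts of a diagram from one
-- model to another. For coherence, compactness yields finitely many equations that imply `∃ y, G`
-- over `T`; EDPC shows that they present the subalgebra. For variable restriction, compactness
-- makes `∀ y, γ` equivalent over `T` to a finite disjunction of finite sets of equations. The empty
-- disjunction is `⊥`; a nonempty one is replaced by a single finite set by means of compact
-- intersections.

universe x y

namespace UnivAlg

open FirstOrder.Language FirstOrder.Language.Structure CategoryTheory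

variable {L : FirstOrder.Language.{u, v}}

/-! ### Sets of equations -/

/-- Equations in the variables `α`. -/
abbrev Eqn (L : FirstOrder.Language.{u, v}) (α : Type*) := L.Term α × L.Term α

section Equations

variable {α β : Type*} {M N : Type*} [L.Structure M] [L.Structure N]

/-- The equation `e` holds under the assignment `a`. -/
def Holds (a : α → M) (e : Eqn L α) : Prop := e.1.realize a = e.2.realize a

/-- All equations in `E` hold under the assignment `a`. -/
def Sat (E : Set (Eqn L α)) (a : α → M) : Prop := ∀ e ∈ E, Holds a e

/-- Renaming of variables in an equation. -/
def Eqn.map (f : α → β) (e : Eqn L α) : Eqn L β := (e.1.relabel f, e.2.relabel f)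

/-- Substitution of terms in an equation. -/
def Eqn.subst (f : α → L.Term β) (e : Eqn L α) : Eqn L β := (e.1.subst f, e.2.subst f)

@[simp] theorem holds_map {f : α → β} {e : Eqn L α} {a : β → M} :
    Holds a (e.map f) ↔ Holds (a ∘ f) e := by
  simp [Holds, Eqn.map]

@[simp] theorem holds_subst {f : α → L.Term β} {e : Eqn L α} {a : β → M} :
    Holds a (e.subst f) ↔ Holds (fun i => (f i).realize a) e := by
  simp [Holds, Eqn.subst]

@[simp] theorem sat_map {f : α → β} {E : Set (Eqn L α)} {a : β → M} :
    Sat (Eqn.map f '' E) a ↔ Sat E (a ∘ f) := by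
  simp only [Sat, Set.forall_mem_image, holds_map]

@[simp] theorem sat_subst {f : α → L.Term β} {E : Set (Eqn L α)} {a : β → M} :
    Sat (Eqn.subst f '' E) a ↔ Sat E (fun i => (f i).realize a) := by
  simp only [Sat, Set.forall_mem_image, holds_subst]

@[simp] theorem sat_union {E F : Set (Eqn L α)} {a : α → M} :
    Sat (E ∪ F) a ↔ Sat E a ∧ Sat F a := by
  simp [Sat, or_imp, forall_and, -Prod.forall]

@[simp] theorem sat_empty {a : α → M} : Sat (∅ : Set (Eqn L α)) a := by
  simp [Sat]

@[simp] theorem sat_singleton {e : Eqn L α} {a : α → M} : Sat {e} a ↔ Holds a e := by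
  simp [Sat, -Prod.forall]

theorem Sat.mono {E F : Set (Eqn L α)} {a : α → M} (h : Sat F a) (hEF : E ⊆ F) : Sat E a :=
  fun e he => h e (hEF he)

theorem Holds.hom {e : Eqn L α} {a : α → M} (h : Holds a e) (f : M →[L] N) : Holds (f ∘ a) e := by
  simp only [Holds, HomClass.realize_term] at h ⊢
  rw [h]

theorem Sat.hom {E : Set (Eqn L α)} {a : α → M} (h : Sat E a) (f : M →[L] N) : Sat E (f ∘ a) :=
  fun e he => (h e he).hom f

@[simp] theorem holds_embedding {e : Eqn L α} {a : α → M} (f : M ↪[L] N) :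
    Holds (f ∘ a) e ↔ Holds a e := by
  simp only [Holds, HomClass.realize_term, f.injective.eq_iff]

@[simp] theorem sat_embedding {E : Set (Eqn L α)} {a : α → M} (f : M ↪[L] N) :
    Sat E (f ∘ a) ↔ Sat E a := by
  simp only [Sat, holds_embedding]

/-- The conjunction of a finite set of equations. -/
noncomputable def conj {E : Set (Eqn L α)} (hE : E.Finite) : L.Formula α :=
  eqConj hE.toFinset.toList

theorem isEqConj_conj {E : Set (Eqn L α)} (hE : E.Finite) : IsEqConj (conj hE) := ⟨_, rfl⟩

theorem realize_eqConj {E : List (Eqn L α)} {a : α → M} :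
    (eqConj E).Realize a ↔ Sat {e | e ∈ E} a := by
  simp only [eqConj, Formula.Realize]
  rw [BoundedFormula.realize_foldr_inf]
  simp only [List.mem_map, forall_exists_index, and_imp, forall_apply_eq_imp_iff₂, Sat, Holds]
  exact forall₂_congr fun e _ => Formula.realize_equal

@[simp] theorem realize_conj {E : Set (Eqn L α)} (hE : E.Finite) {a : α → M} :
    (conj hE).Realize a ↔ Sat E a := by
  simp [conj, realize_eqConj]

theorem realize_weaken {n : ℕ} {φ : L.Formula (Fin n)} {a : Fin (n + 1) → M} :
    (weaken φ).Realize a ↔ φ.Realize (a ∘ Fin.castSucc) := by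
  simp [weaken]

theorem IsEqConj.exists_sat {φ : L.Formula α} (h : IsEqConj φ) :
    ∃ E : Set (Eqn L α), E.Finite ∧
      ∀ (M : Type w) [L.Structure M] (a : α → M), φ.Realize a ↔ Sat E a := by
  obtain ⟨E, rfl⟩ := h
  exact ⟨{e | e ∈ E}, List.finite_toSet E, fun M _ a => realize_eqConj⟩

end Equations

/-! ### Homomorphisms out of generated algebras -/

section Generated

variable {X : Type*} {M N : Type*} [L.Structure M] [L.Structure N]

theorem exists_term_of_mem_closure {a : X → M} {m : M}
    (h : m ∈ Substructure.closure L (Set.range a)) : ∃ t : L.Term X, t.realize a = m := by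
  obtain ⟨t, ht⟩ := Substructure.mem_closure_iff_exists_term.1 h
  refine ⟨t.relabel fun s => s.2.choose, ?_⟩
  rw [Term.realize_relabel, ← ht]
  congr 1
  funext s
  exact s.2.choose_spec

theorem realize_mem_closure (a : X → M) (t : L.Term X) :
    t.realize a ∈ Substructure.closure L (Set.range a) := by
  induction t with
  | var i => exact Substructure.subset_closure ⟨i, rfl⟩
  | func f ts ih => exact Substructure.fun_mem _ f _ ih

variable [L.IsAlgebraic]

theorem exists_hom_of_holds {a : X → M} (ha : Substructure.closure L (Set.range a) = ⊤)
    {b : X → N} (h : ∀ e : Eqn L X, Holds a e → Holds b e) :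
    ∃ f : M →[L] N, ∀ i, f (a i) = b i := by
  have hs : ∀ m : M, ∃ t : L.Term X, t.realize a = m := fun m =>
    exists_term_of_mem_closure (ha ▸ Substructure.mem_top m)
  choose t ht using hs
  refine ⟨⟨fun m => (t m).realize b, ?_, fun {n} r => isEmptyElim r⟩, fun i => ?_⟩
  · intro n f y
    refine h (t (funMap f y), Term.func f fun i => t (y i)) ?_
    simp [Holds, ht]
  · exact h (t (a i), Term.var i) (by simp [Holds, ht])

theorem exists_embedding_of_holds_iff {a : X → M}
    (ha : Substructure.closure L (Set.range a) = ⊤)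
    {b : X → N} (h : ∀ e : Eqn L X, Holds a e ↔ Holds b e) :
    ∃ f : M ↪[L] N, ∀ i, f (a i) = b i := by
  obtain ⟨f, hf⟩ := exists_hom_of_holds ha fun e => (h e).1
  have hinj : Function.Injective f := by
    intro p q hpq
    obtain ⟨s, rfl⟩ := exists_term_of_mem_closure (ha ▸ Substructure.mem_top p)
    obtain ⟨t, rfl⟩ := exists_term_of_mem_closure (ha ▸ Substructure.mem_top q)
    rw [← HomClass.realize_term, ← HomClass.realize_term] at hpq
    have : f ∘ a = b := funext hf
    rw [this] at hpq
    exact (h (s, t)).2 hpq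
  exact ⟨Embedding.ofInjective hinj, hf⟩

theorem exists_embedding_of_holds_id {b : M → N}
    (h : ∀ e : Eqn L M, Holds id e ↔ Holds b e) : ∃ f : M ↪[L] N, ∀ m, f m = b m :=
  exists_embedding_of_holds_iff (a := id) (by simp) h

end Generated

/-- The generators of the subalgebra generated by a tuple. -/
def gens (L : FirstOrder.Language.{u, v}) {X M : Type*} [L.Structure M] (a : X → M) :
    X → Substructure.closure L (Set.range a) :=
  fun i => ⟨a i, Substructure.subset_closure ⟨i, rfl⟩⟩

section Gens

variable {X M : Type*} [L.Structure M] (a : X → M)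

theorem subtype_comp_gens :
    (Substructure.closure L (Set.range a)).subtype ∘ gens L a = a := rfl

theorem closure_range_gens : Substructure.closure L (Set.range (gens L a)) = ⊤ := by
  rw [eq_top_iff]
  rintro ⟨m, hm⟩ -
  obtain ⟨t, rfl⟩ := exists_term_of_mem_closure hm
  have h : t.realize (gens L a) = ⟨t.realize a, hm⟩ :=
    Subtype.ext (HomClass.realize_term (Substructure.closure L (Set.range a)).subtype
      (v := gens L a)).symm
  exact h ▸ realize_mem_closure (gens L a) t

@[simp] theorem holds_gens {e : Eqn L X} : Holds (gens L a) e ↔ Holds a e := by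
  rw [← holds_embedding (Substructure.closure L (Set.range a)).subtype, subtype_comp_gens]

@[simp] theorem sat_gens {E : Set (Eqn L X)} : Sat E (gens L a) ↔ Sat E a := by
  simp [Sat, -Prod.forall]

end Gens

/-! ### Consequence in a class, and presented algebras -/

/-- The equation `e` holds in the members of `V` under all assignments satisfying `Θ`. -/
def Entails (V : Set (Bundled.{w} L.Structure)) {X : Type*} (Θ : Set (Eqn L X)) (e : Eqn L X) :
    Prop :=
  ∀ A ∈ V, ∀ a : X → A, Sat Θ a → Holds a e

theorem Entails.of_mem {V : Set (Bundled.{w} L.Structure)} {X : Type*} {Θ : Set (Eqn L X)}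
    {e : Eqn L X} (h : e ∈ Θ) : Entails V Θ e := fun _ _ _ ha => ha e h

section Variety

theorem term_realize_pi {ι : Type w} (A : ι → Bundled.{w} L.Structure) {X : Type*} (t : L.Term X)
    (a : ∀ i, X → A i) (i : ι) :
    (t.realize (M := (piBundled A : Type w)) fun k i => a i k) i = t.realize (a i) := by
  induction t with
  | var k => rfl
  | func f ts ih => 
    simp only [Term.realize]
    refine Eq.trans ?_ (congrArg (funMap f) (funext ih))
    rfl

/-- The algebra presented by generators `X` and relations `Θ`, as a member of a variety. -/
theorem exists_presented {V : Set (Bundled.{max u v w x} L.Structure)} (hV : IsVariety V)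
    {X : Type x} (Θ : Set (Eqn L X)) : ∃ F ∈ V, ∃ g : X → F,
      Substructure.closure L (Set.range g) = ⊤ ∧ ∀ e, Holds g e ↔ Entails V Θ e := by
  classical
  -- One countermodel for each equation that is not entailed is enough: the algebra sought is the
  -- subalgebra of their product generated by the tuple of assignments.
  let ι : Type (max u v w x) := {i : ULift.{max v w} (Eqn L X) // ¬ Entails V Θ i.down}
  have hι : ∀ i : ι, ∃ A ∈ V, ∃ a : X → A, Sat Θ a ∧ ¬ Holds a i.1.down := by
    intro i
    have := i.2
    simp only [Entails, not_forall] at this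
    obtain ⟨A, hA, a, ha, h⟩ := this
    exact ⟨A, hA, a, ha, h⟩
  choose A hA a ha hne using hι
  let P := piBundled A
  let p : X → P := fun k i => a i k
  have hp : ∀ e, Holds p e ↔ Entails V Θ e := by
    intro e
    constructor
    · intro h
      by_contra hn
      apply hne ⟨⟨e⟩, hn⟩
      have := congrFun h (⟨⟨e⟩, hn⟩ : ι)
      rw [term_realize_pi, term_realize_pi] at this
      exact this
    · intro h
      funext i
      rw [term_realize_pi, term_realize_pi]
      exact h (A i) (hA i) (a i) (ha i)
  refine ⟨⟨Substructure.closure L (Set.range p), inferInstance⟩,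
    hV.subalgebra P _ (hV.product ι A hA) ⟨(Substructure.closure L (Set.range p)).subtype⟩,
    gens L p, closure_range_gens p, fun e => ?_⟩
  rw [← hp e]
  exact holds_gens p

variable {V : Set (Bundled.{w} L.Structure)}

theorem IsVariety.substructure_mem (hV : IsVariety V) {A : Bundled.{w} L.Structure} (hA : A ∈ V)
    (S : L.Substructure A) : (⟨S, inferInstance⟩ : Bundled.{w} L.Structure) ∈ V :=
  hV.subalgebra A _ hA ⟨S.subtype⟩

end Variety

/-- Birkhoff's theorem: a variety contains all algebras satisfying its equations. -/
theorem IsVariety.mem_of_holds [L.IsAlgebraic] {V : Set (Bundled.{max u v w} L.Structure)}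
    (hV : IsVariety V) (M : Bundled.{max u v w} L.Structure)
    (h : ∀ (n : ℕ) (e : Eqn L (Fin n)), Entails V ∅ e → ∀ a : Fin n → M, Holds a e) : M ∈ V := by
  classical
  -- `M` is an image of the free algebra on its own elements, provided every equation valid in `V`
  -- holds in `M` under `id`.
  obtain ⟨F, hF, g, hg, hge⟩ := exists_presented.{u, v, w, max u v w} hV (X := M) ∅
  obtain ⟨f, hf⟩ := exists_hom_of_holds (a := g) (b := (id : M → M)) hg (by
    intro e he
    rw [hge] at he
    let s := e.1.varFinset ∪ e.2.varFinset
    let r : Fin s.card ≃ s := s.equivFin.symm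
    -- The hypothesis speaks of variables in `Fin n` only, so `e` is rewritten in the finitely many
    -- variables that occur in it.
    let e' : Eqn L (Fin s.card) :=
      (e.1.restrictVar fun i => r.symm ⟨i, Finset.mem_union_left _ i.2⟩,
       e.2.restrictVar fun i => r.symm ⟨i, Finset.mem_union_right _ i.2⟩)
    have key : ∀ (N : Bundled.{max u v w} L.Structure) (b : Fin s.card → N) (c : M → N),
        (∀ i, b (r.symm i) = c i) → (Holds b e' ↔ Holds c e) := by
      intro N b c hbc
      simp only [Holds, e']
      rw [Term.realize_restrictVar c (fun i => hbc ⟨i, Finset.mem_union_left _ i.2⟩),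
        Term.realize_restrictVar c (fun i => hbc ⟨i, Finset.mem_union_right _ i.2⟩)]
    rw [← key M (fun i => r i) id (by simp)]
    refine h _ _ (fun A hA b _ => ?_) _
    -- Variables outside `s` need some value in `A`; one exists, because the term `e'.1` already has
    -- a value there.
    by_cases hM : Nonempty A
    · rw [key A b (fun m => if hm : m ∈ s then b (r.symm ⟨m, hm⟩) else hM.some) (by simp)]
      exact he A hA _ sat_empty
    · exact (hM ⟨e'.1.realize b⟩).elim)
  exact hV.homImage F M hF f fun m => ⟨g m, hf m⟩

/-! ### Quotients by congruences -/

section Congruence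

variable {A : Type*} [L.Structure A]

theorem isCongruence_congruenceGen (S : Set (A × A)) :
    IsCongruence L (congruenceGen L S) := by
  intro n f x y h
  rw [congruenceGen, Setoid.sInf_def]
  simp only [sInf_apply, iInf_apply, iInf_Prop_eq]
  rintro ⟨_, r, hr, rfl⟩
  refine hr.1 n f x y fun i => ?_
  have := h i
  rw [congruenceGen, Setoid.sInf_def] at this
  simp only [sInf_apply, iInf_apply, iInf_Prop_eq] at this
  exact this ⟨_, r, hr, rfl⟩

theorem congruenceGen_of_mem {S : Set (A × A)} {p : A × A} (hp : p ∈ S) :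
    congruenceGen L S p.1 p.2 := by
  rw [congruenceGen, Setoid.sInf_def]
  simp only [sInf_apply, iInf_apply, iInf_Prop_eq]
  rintro ⟨_, r, hr, rfl⟩
  exact hr.2 p hp

theorem congruenceGen_le {S : Set (A × A)} {r : Setoid A} (hr : IsCongruence L r)
    (h : ∀ p ∈ S, r p.1 p.2) : congruenceGen L S ≤ r :=
  sInf_le ⟨hr, h⟩

theorem isCongruence_ker {B : Type*} [L.Structure B] (f : A →[L] B) :
    IsCongruence L (Setoid.ker f) := by
  intro n F x y h
  simp only [Setoid.ker_def] at h ⊢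
  rw [HomClass.map_fun, HomClass.map_fun]
  congr 1
  funext i
  exact h i

end Congruence

theorem exists_quotient [L.IsAlgebraic] {V : Set (Bundled.{w} L.Structure)} (hV : IsVariety V)
    {A : Bundled.{w} L.Structure} (hA : A ∈ V) {r : Setoid A} (hr : IsCongruence L r) :
    ∃ B ∈ V, ∃ f : A →[L] B, Function.Surjective f ∧ ∀ a b, f a = f b ↔ r a b := by
  let ps : L.Prestructure r :=
    { toStructure := inferInstance
      fun_equiv := fun {n} {f} x y h => hr n f x y h
      rel_equiv := fun {n} {R} => isEmptyElim R }
  let f : A →[L] (Quotient r) :=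
    ⟨fun a => ⟦a⟧, fun F y => (funMap_quotient_mk' r F y).symm, fun {n} R => isEmptyElim R⟩
  have hf : Function.Surjective f := Quotient.mk_surjective
  exact ⟨⟨Quotient r, inferInstance⟩, hV.homImage A _ hA f hf, f, hf, fun a b => Quotient.eq⟩

/-! ### Dual relative pseudocomplements from EDPC -/

/-- Induction on `G`: if `K₀` expresses the implication for the remaining equations, then adding `g`
amounts to requiring, for each `k` in `K₀`, that `k` lie in the principal congruence generated by
`g`. EDPC turns this into equations. -/
theorem HasEDPC.exists_imp [L.IsAlgebraic] {V : Set (Bundled.{w} L.Structure)} (hV : IsVariety V)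
    (hE : HasEDPC V) {α : Type*} {G H : Set (Eqn L α)} (hG : G.Finite) (hH : H.Finite) :
    ∃ K : Set (Eqn L α), K.Finite ∧ ∀ A ∈ V, ∀ a : α → A,
      (Sat K a ↔ ∀ B ∈ V, ∀ f : A →[L] B, Sat G (f ∘ a) → Sat H (f ∘ a)) := by
  obtain ⟨φ, hφ, hφV⟩ := hE
  obtain ⟨D, hD, hφD⟩ := hφ.exists_sat
  induction G, hG using Set.Finite.induction_on with
  | empty =>
    exact ⟨H, hH, fun A hA a => ⟨fun h B _ f _ => h.hom f, fun h => h A hA (Hom.id L A) sat_empty⟩⟩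
  | @insert g G _ _ ih =>
    obtain ⟨K₀, hK₀, h₀⟩ := ih
    refine ⟨⋃ k ∈ K₀, Eqn.subst ![k.1, k.2, g.1, g.2] '' D,
      hK₀.biUnion fun k _ => hD.image _, fun A hA a => ?_⟩
    -- A homomorphism validates `g` iff its kernel contains the principal congruence of `g`, and the
    -- quotient by that congruence is the test case for the converse.
    have hprin : ∀ k : Eqn L α, Sat (Eqn.subst ![k.1, k.2, g.1, g.2] '' D) a ↔
        ∀ B ∈ V, ∀ f : A →[L] B, Holds (f ∘ a) g → Holds (f ∘ a) k := by
      intro k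
      have hvec : (fun i => (![k.1, k.2, g.1, g.2] i : L.Term α).realize a) =
          ![k.1.realize a, k.2.realize a, g.1.realize a, g.2.realize a] := by
        funext i
        fin_cases i <;> rfl
      rw [sat_subst, hvec, ← hφD A, ← hφV A hA]
      constructor
      · intro h B _ f hg
        have hle : congruenceGen L {(g.1.realize a, g.2.realize a)} ≤ Setoid.ker f := by
          refine congruenceGen_le (isCongruence_ker f) ?_
          rintro _ rfl
          simpa only [Holds, HomClass.realize_term, Setoid.ker_def] using hg
        have := hle h
        simpa only [Holds, HomClass.realize_term, Setoid.ker_def] using this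
      · intro h
        obtain ⟨B, hB, f, -, hf⟩ := exists_quotient hV hA
          (isCongruence_congruenceGen (L := L) {(g.1.realize a, g.2.realize a)})
        rw [← hf]
        have := h B hB f (by
          simp only [Holds, HomClass.realize_term]
          rw [hf]
          exact congruenceGen_of_mem (L := L) (Set.mem_singleton _))
        simpa only [Holds, HomClass.realize_term] using this
    have hsat : Sat (⋃ k ∈ K₀, Eqn.subst ![k.1, k.2, g.1, g.2] '' D) a ↔
        ∀ k ∈ K₀, Sat (Eqn.subst ![k.1, k.2, g.1, g.2] '' D) a := by
      simp only [Sat, Set.mem_iUnion]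
      exact ⟨fun h k hk e he => h e ⟨k, hk, he⟩, fun h e ⟨k, hk, he⟩ => h k hk e he⟩
    rw [hsat]
    simp only [hprin]
    constructor
    · intro h B hB f hfG
      have hK : Sat K₀ (f ∘ a) := fun k hk => h k hk B hB f (hfG g (Set.mem_insert _ _))
      exact (h₀ B hB _).1 hK B hB (Hom.id L B) (hfG.mono (Set.subset_insert _ _))
    · intro h k hk B hB f hg
      refine (h₀ B hB (f ∘ a)).2 (fun C hC f' hG' => ?_) k hk
      refine h C hC (f'.comp f) ?_
      rintro e (rfl | he)
      · exact hg.hom f'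
      · exact hG' e he

/-! ### Compactness -/

/-- A family of formulas with free variables in `X` is realized in some model of `T` if all its
finite subfamilies are. -/
theorem exists_realize_of_finset {T : L.Theory} {X : Type x} {ι : Type*} (Γ : ι → L.Formula X)
    (h : ∀ s : Finset ι, ∃ (M : Theory.ModelType.{u, v, max u v w x} T) (a : X → M),
      ∀ i ∈ s, (Γ i).Realize a) :
    ∃ (M : Theory.ModelType.{u, v, max u v w x} T) (a : X → M), ∀ i, (Γ i).Realize a := by
  classical
  -- The index `none` carries `T` itself; the variables in `X` become new constants.
  let S : Option ι → L[[X]].Theory := fun o =>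
    o.elim ((L.lhomWithConstants X).onTheory T) fun i => {Formula.equivSentence (Γ i)}
  have key : Theory.IsSatisfiable (⋃ o, S o) := by
    rw [Theory.isSatisfiable_iUnion_iff_isSatisfiable_iUnion_finset]
    intro s
    obtain ⟨M, a, ha⟩ := h s.eraseNone
    let : (constantsOn X).Structure M := constantsOn.structure a
    have : M ⊨ ⋃ o ∈ s, S o := by
      rw [Theory.model_iff]
      intro φ hφ
      simp only [Set.mem_iUnion] at hφ
      obtain ⟨o, ho, hφ⟩ := hφ
      cases o with
      | none =>
        have : M ⊨ (L.lhomWithConstants X).onTheory T := (LHom.onTheory_model _ _).2 inferInstance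
        exact this.realize_of_mem φ hφ
      | some i =>
        obtain rfl : φ = _ := hφ
        exact (Formula.realize_equivSentence _ _).2 (ha i (by simpa using ho))
    exact Theory.Model.isSatisfiable M
  obtain ⟨N₀⟩ := key
  let N := Theory.ModelType.ulift.{_, _, _, max u v w x} N₀
  have hS : ∀ o, N ⊨ S o := fun o => N.is_model.mono (Set.subset_iUnion S o)
  let := (L.lhomWithConstants X).reduct N
  have : N ⊨ T := (LHom.onTheory_model (L.lhomWithConstants X) T).1 (hS none)
  refine ⟨Theory.ModelType.of T N, fun i => (L.con i : N), fun i => ?_⟩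
  exact (Formula.realize_equivSentence N (Γ i)).1 ((hS (some i)).realize_of_mem _ rfl)

/-- Existential quantification over an arbitrary, possibly infinite, set of variables. -/
theorem exists_formula_exists {Y Z : Type*} (φ : L.Formula (Y ⊕ Z)) : ∃ ψ : L.Formula Y,
    ∀ (N : Type w) [L.Structure N] [Nonempty N] (a : Y → N),
      ψ.Realize a ↔ ∃ b : Z → N, φ.Realize (Sum.elim a b) := by
  classical
  -- Only the finitely many variables of `Z` that occur in `φ` need a quantifier; the others take a
  -- default value below.
  let Z₀ : Finset Z := φ.freeVarFinset.toRight
  let f : φ.freeVarFinset → Y ⊕ Z₀ := fun i =>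
    match i with
    | ⟨.inl y, _⟩ => .inl y
    | ⟨.inr z, hz⟩ => .inr ⟨z, by simpa [Z₀] using hz⟩
  refine ⟨Formula.iExs Z₀ (φ.restrictFreeVar f), fun N _ _ a => ?_⟩
  rw [Formula.realize_iExs]
  constructor
  · rintro ⟨b, hb⟩
    let b' : Z → N := fun z => if hz : z ∈ Z₀ then b ⟨z, hz⟩ else Classical.arbitrary N
    refine ⟨b', (BoundedFormula.realize_restrictFreeVar (f := f) (Sum.elim a b') ?_).1 hb⟩
    rintro ⟨y | z, hz⟩
    · rfl
    · have : z ∈ Z₀ := by simpa [Z₀] using hz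
      simp [f, b', this]
  · rintro ⟨b, hb⟩
    refine ⟨fun z => b z, (BoundedFormula.realize_restrictFreeVar (Sum.elim a b) ?_).2 hb⟩
    rintro ⟨y | z, hz⟩ <;> rfl

/-- Existential quantification over the last variable. -/
theorem exists_formula_exists_last {n : ℕ} (φ : L.Formula (Fin (n + 1))) :
    ∃ ψ : L.Formula (Fin n), ∀ (N : Type w) [L.Structure N] [Nonempty N] (a : Fin n → N),
      ψ.Realize a ↔ ∃ b : Fin (n + 1) → N, b ∘ Fin.castSucc = a ∧ φ.Realize b := by
  let τ : Fin (n + 1) → Fin n ⊕ Unit := Fin.lastCases (Sum.inr ()) Sum.inl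
  obtain ⟨ψ, hψ⟩ := exists_formula_exists.{u, v, w} (φ.relabel τ)
  refine ⟨ψ, fun N _ _ a => ?_⟩
  simp only [hψ, Formula.realize_relabel]
  constructor
  · rintro ⟨b, hb⟩
    refine ⟨_, ?_, hb⟩
    funext i
    simp [τ]
  · rintro ⟨b, rfl, hb⟩
    refine ⟨fun _ => b (Fin.last n), ?_⟩
    convert hb using 1
    funext i
    refine Fin.lastCases ?_ (fun i => ?_) i <;> simp [τ]

/-- The universal closure of a formula. -/
theorem exists_sentence_forall {X : Type*} (φ : L.Formula X) : ∃ σ : L.Sentence,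
    ∀ (N : Type w) [L.Structure N] [Nonempty N], N ⊨ σ ↔ ∀ a : X → N, φ.Realize a := by
  obtain ⟨ψ, hψ⟩ := exists_formula_exists.{u, v, w}
    (φ.not.relabel Sum.inr : L.Formula (Empty ⊕ X))
  refine ⟨ψ.not, fun N _ _ => ?_⟩
  rw [Sentence.realize_not, Sentence.Realize, hψ]
  simp

/-! ### Models of the theory of a variety -/

/-- The universal closure of an equation. -/
noncomputable def closedEqn {n : ℕ} (e : Eqn L (Fin n)) : L.Sentence :=
  ((e.1.relabel (Sum.inr : Fin n → Empty ⊕ Fin n)).bdEqual (e.2.relabel Sum.inr)).alls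

theorem realize_closedEqn {n : ℕ} (e : Eqn L (Fin n)) {M : Type*} [L.Structure M] :
    M ⊨ closedEqn e ↔ ∀ a : Fin n → M, Holds a e := by
  rw [Sentence.Realize, closedEqn, BoundedFormula.realize_alls]
  simp [Holds]

theorem isUniversal_alls {α : Type*} {n : ℕ} {φ : L.BoundedFormula α n} (h : φ.IsUniversal) :
    φ.alls.IsUniversal := by
  induction n with
  | zero => exact h
  | succ n ih => exact ih h.all

theorem isUniversal_closedEqn {n : ℕ} (e : Eqn L (Fin n)) : (closedEqn e).IsUniversal :=
  isUniversal_alls (BoundedFormula.IsAtomic.equal _ _).isUniversal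

theorem closedEqn_mem_theoryOf {V : Set (Bundled.{w} L.Structure)} {n : ℕ} {e : Eqn L (Fin n)}
    (h : Entails V ∅ e) : closedEqn e ∈ theoryOf V :=
  fun A hA => (realize_closedEqn e).2 fun a => h A hA a sat_empty

theorem model_theoryOf {V : Set (Bundled.{w} L.Structure)} {A : Bundled.{w} L.Structure}
    (hA : A ∈ V) : A ⊨ theoryOf V :=
  ⟨fun _ hφ => hφ A hA⟩

theorem nonempty_of_constants [Nonempty L.Constants] (M : Type*) [L.Structure M] : Nonempty M :=
  ⟨((Classical.arbitrary L.Constants : L.Constants) : M)⟩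

section Models

variable [L.IsAlgebraic]

theorem IsVariety.mem_of_model {V : Set (Bundled.{max u v w} L.Structure)} (hV : IsVariety V) (M : Bundled.{max u v w} L.Structure)
    (h : M ⊨ theoryOf V) : M ∈ V :=
  hV.mem_of_holds M fun _ e he =>
    (realize_closedEqn e).1 (h.realize_of_mem _ (closedEqn_mem_theoryOf he))

/-- Consequences of a set of equations are consequences of a finite subset. -/
theorem Entails.exists_finite [Nonempty L.Constants] {V : Set (Bundled.{max u v w x} L.Structure)}
    (hV : IsVariety V) {X : Type x} {Θ : Set (Eqn L X)} {e : Eqn L X} (h : Entails V Θ e) :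
    ∃ E ⊆ Θ, E.Finite ∧ Entails V E e := by
  classical
  by_contra hn
  push Not at hn
  -- The index `none` carries the negation of `e`, the others the equations of `Θ`.
  obtain ⟨M, a, ha⟩ := exists_realize_of_finset.{u, v, w, x} (T := theoryOf V) (X := X)
    (ι := Option Θ) (fun o => o.elim (e.1.equal e.2).not fun d => d.1.1.equal d.1.2) (by
      intro s
      have := hn (Subtype.val '' (s.eraseNone : Set Θ)) (by simp) (Set.toFinite _)
      simp only [Entails, not_forall] at this
      obtain ⟨A, hA, a, ha, hne⟩ := this
      have := model_theoryOf hA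
      have := nonempty_of_constants (L := L) A
      refine ⟨Theory.ModelType.of _ A, a, ?_⟩
      rintro (_ | d) hd
      · exact fun hh => hne (Formula.realize_equal.1 hh)
      · exact Formula.realize_equal.2 (ha d ⟨d, by simpa using hd, rfl⟩))
  refine ha none (Formula.realize_equal.2 (h ⟨M, inferInstance⟩ ?_ a ?_))
  · exact IsVariety.mem_of_model.{u, v, max w x} hV _ M.is_model
  · exact fun d hd => Formula.realize_equal.1 (ha (some ⟨d, hd⟩))

end Models

/-! ### Monotonicity and finiteness of entailment -/

section Entailment

variable {V : Set (Bundled.{w} L.Structure)} {X Y : Type*}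

theorem Entails.mono {Θ Θ' : Set (Eqn L X)} {e : Eqn L X} (h : Entails V Θ e) (hΘ : Θ ⊆ Θ') :
    Entails V Θ' e :=
  fun A hA a ha => h A hA a (ha.mono hΘ)

theorem Entails.exists_finite_image [L.IsAlgebraic] [Nonempty L.Constants]
    {V : Set (Bundled.{max u v w x} L.Structure)}
    (hV : IsVariety V) {X : Type x} {f : Y → X} {Θ : Set (Eqn L Y)} {Δ : Set (Eqn L X)}
    {e : Eqn L X} (h : Entails V (Eqn.map f '' Θ ∪ Δ) e) :
    ∃ E ⊆ Θ, E.Finite ∧ Entails V (Eqn.map f '' E ∪ Δ) e := by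
  obtain ⟨E, hE, hfin, he⟩ := Entails.exists_finite.{u, v, w, x} hV h
  refine Set.exists_subset_image_finite_and (p := fun t => Entails V (t ∪ Δ) e) |>.1
    -- Only the premises outside `Δ` have to be lifted along `f`; `Δ` itself may stay infinite.
    ⟨E \ Δ, ?_, hfin.subset Set.sdiff_subset, he.mono ?_⟩
  · rintro d ⟨hd, hn⟩
    exact (hE hd).resolve_right hn
  · intro d hd
    by_cases h : d ∈ Δ
    · exact .inr h
    · exact .inl ⟨hd, h⟩

end Entailment

/-! ### Diagrams -/

section Diagram

variable {M N : Type*} [L.Structure M] [L.Structure N]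

/-- The conjunct of the diagram of `M` that decides the equation `e`. -/
noncomputable def diagramFormula (M : Type*) [L.Structure M] (e : Eqn L M) : L.Formula M :=
  open Classical in if Holds id e then e.1.equal e.2 else (e.1.equal e.2).not

theorem realize_diagramFormula {e : Eqn L M} {a : M → N} :
    (diagramFormula M e).Realize a ↔ (Holds id e ↔ Holds a e) := by
  unfold diagramFormula
  split_ifs with h
  · rw [Formula.realize_equal]
    exact (iff_true_left h).symm
  · rw [Formula.realize_not, Formula.realize_equal]
    exact (iff_false_left h).symm

/-- An embedding as an embedding in the language with constants for the domain. -/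
def embeddingWithConstants (f : M ↪[L] N) :
    letI : (constantsOn M).Structure N := constantsOn.structure f
    M ↪[L[[M]]] N :=
  letI : (constantsOn M).Structure N := constantsOn.structure f
  ⟨f.toEmbedding, by
    intro n g x
    cases g with
    | inl g => exact f.map_fun' g x
    | inr c =>
      cases n with
      | zero => rfl
      | succ n => exact isEmptyElim c, by
    intro n R x
    cases R with
    | inl R => exact f.map_rel' R x
    | inr r => exact isEmptyElim r⟩

end Diagram

theorem model_diagram {M : Type w} {N : Type y} [L.Structure M] [L.Structure N] (f : M ↪[L] N) :
    letI : (constantsOn M).Structure N := constantsOn.structure f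
    N ⊨ diagram L M := by
  let : (constantsOn M).Structure N := constantsOn.structure f
  rw [Theory.model_iff]
  rintro φ ⟨hφ, hM⟩
  have hqf : φ.IsQF := by
    rcases hφ with h | ⟨ψ, h, rfl⟩
    · exact h.isQF
    · exact h.isQF.not
  have := (hqf.realize_embedding (embeddingWithConstants f) (v := default) (xs := default)).2 hM
  have h₀ : (embeddingWithConstants f ∘ default : Empty → N) = default := Subsingleton.elim _ _
  have h₁ : (embeddingWithConstants f ∘ default : Fin 0 → N) = default := Subsingleton.elim _ _
  rw [h₀, h₁] at this
  exact this

theorem equivSentence_diagramFormula_mem {M : Type w} [L.Structure M] (e : Eqn L M) :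
    Formula.equivSentence (diagramFormula M e) ∈ diagram L M := by
  have hat : (Formula.equivSentence (e.1.equal e.2) : L[[M]].Sentence).IsAtomic :=
    BoundedFormula.IsAtomic.equal _ _
  refine ⟨?_, (Formula.realize_equivSentence M _).2 (realize_diagramFormula.2 Iff.rfl)⟩
  unfold diagramFormula
  split_ifs
  · exact .inl hat
  · exact .inr ⟨_, hat, Formula.equivSentence_not _⟩

theorem exists_embedding_of_model_diagram [L.IsAlgebraic] {M : Type w} {N : Type y}
    [L.Structure M] [L.Structure N] [L[[M]].Structure N]
    [(L.lhomWithConstants M).IsExpansionOn N] (h : N ⊨ diagram L M) :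
    ∃ f : M ↪[L] N, ∀ m, f m = (L.con m : N) :=
  exists_embedding_of_holds_id (b := fun m => (L.con m : N)) fun e =>
    realize_diagramFormula.1 ((Formula.realize_equivSentence N _).1
      (h.realize_of_mem _ (equivSentence_diagramFormula_mem e)))

/-! ### Consequences of having a model completion -/

section ModelCompletion

variable {V : Set (Bundled.{max u v w} L.Structure)}
  {T : L.Theory}

/-- The equations of `V` are universal sentences, hence shared by `T`; Birkhoff's theorem does the
rest. -/
theorem IsModelCompletion.mem [L.IsAlgebraic] (hV : IsVariety V)
    (hT : IsModelCompletion.{u, v, max u v w} (theoryOf V) T)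
    (N : Theory.ModelType.{u, v, max u v w} T) : (⟨N, inferInstance⟩ : Bundled.{max u v w} L.Structure) ∈ V := by
  refine IsVariety.mem_of_holds.{u, v, w} hV _ fun n e he => (realize_closedEqn e).1 ?_
  exact ((hT.1.2 _ (isUniversal_closedEqn e)).1
    (Theory.models_sentence_of_mem (closedEqn_mem_theoryOf he))).realize_sentence N

/-- The right side does not mention `f` or `N`: since `T` with the diagram of `M` is complete, the
truth of `φ` at `M` is the same in every model of `T` extending `M`. -/
theorem IsModelCompletion.realize_iff [Nonempty L.Constants]
    (hT : IsModelCompletion.{u, v, max u v w} (theoryOf V) T)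
    {M : Bundled.{max u v w} L.Structure} (hM : M ∈ V)
    {N : Theory.ModelType.{u, v, max u v w} T} (f : M ↪[L] N) (φ : L.Formula M) :
    φ.Realize f ↔
      (L.lhomWithConstants M).onTheory T ∪ diagram L M ⊨ᵇ Formula.equivSentence φ := by
  have := nonempty_of_constants (L := L) M
  have := model_theoryOf hM
  let : (constantsOn M).Structure N := constantsOn.structure f
  have h₁ : N ⊨ diagram L M := model_diagram f
  have h₂ : N ⊨ (L.lhomWithConstants M).onTheory T := (LHom.onTheory_model _ _).2 inferInstance
  have := h₂.union h₁
  rw [← (hT.2 M (model_theoryOf hM)).realize_sentence_iff _ N]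
  exact (Formula.realize_equivSentence N φ).symm

variable [L.IsAlgebraic] [Nonempty L.Constants]

theorem IsModelCompletion.exists_embedding
    (hT : IsModelCompletion.{u, v, max u v w} (theoryOf V) T)
    {M : Bundled.{max u v w} L.Structure} (hM : M ∈ V) :
    ∃ N : Theory.ModelType.{u, v, max u v w} T, Nonempty (M ↪[L] N) := by
  have := nonempty_of_constants (L := L) M
  obtain ⟨N⟩ := (hT.2 M (model_theoryOf hM)).1
  have h₁ : N ⊨ (L.lhomWithConstants M).onTheory T := N.is_model.mono Set.subset_union_left
  have h₂ : N ⊨ diagram L M := N.is_model.mono Set.subset_union_right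
  let := (L.lhomWithConstants M).reduct N
  have : N ⊨ T := (LHom.onTheory_model (L.lhomWithConstants M) T).1 h₁
  obtain ⟨f, -⟩ := exists_embedding_of_model_diagram h₂
  exact ⟨Theory.ModelType.of T N, ⟨f⟩⟩

/-- Tuples satisfying the same equations in two models of the model completion satisfy the same
formulas. -/
theorem IsModelCompletion.transfer (hV : IsVariety V)
    (hT : IsModelCompletion.{u, v, max u v w} (theoryOf V) T)
    {N₁ N₂ : Theory.ModelType.{u, v, max u v w} T} {X : Type*} {a₁ : X → N₁} {a₂ : X → N₂}
    (h : ∀ e : Eqn L X, Holds a₁ e ↔ Holds a₂ e) (φ : L.Formula X) :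
    φ.Realize a₁ ↔ φ.Realize a₂ := by
  -- The algebra generated by `a₁` embeds into both models, sending its generators to `a₁` and to
  -- `a₂`.
  let M : Bundled.{max u v w} L.Structure :=
    ⟨Substructure.closure L (Set.range a₁), inferInstance⟩
  have hM : M ∈ V := hV.substructure_mem (hT.mem hV N₁) _
  obtain ⟨f, hf⟩ := exists_embedding_of_holds_iff (closure_range_gens (L := L) a₁) (b := a₂)
    fun e => by rw [holds_gens, h]
  have h₁ := hT.realize_iff hM (Substructure.closure L (Set.range a₁)).subtype
    (φ.relabel (gens L a₁))
  have h₂ := hT.realize_iff hM f (φ.relabel (gens L a₁))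
  rw [Formula.realize_relabel] at h₁ h₂
  have h₃ : f ∘ gens L a₁ = a₂ := funext hf
  rw [h₃] at h₂
  exact h₁.trans h₂.symm

theorem IsModelCompletion.amalgamation (hV : IsVariety V)
    (hT : IsModelCompletion.{u, v, max u v w} (theoryOf V) T) : Amalgamation V := by
  classical
  intro M N P MN MP hM hN hP
  obtain ⟨N', ⟨f⟩⟩ := hT.exists_embedding hN
  obtain ⟨P', ⟨g⟩⟩ := hT.exists_embedding hP
  -- The amalgam as a set of formulas: both diagrams, and the identification of the two images of
  -- each element of `M`.
  let Γ : Eqn L N ⊕ (Eqn L P ⊕ M) → L.Formula (N ⊕ P) := Sum.elim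
    (fun e => (diagramFormula N e).relabel Sum.inl)
    (Sum.elim (fun e => (diagramFormula P e).relabel Sum.inr)
      fun m => (Term.var (Sum.inl (MN m))).equal (Term.var (Sum.inr (MP m))))
  obtain ⟨Q, a, ha⟩ := exists_realize_of_finset.{u, v, w, max u v w} (T := theoryOf V) Γ (by
    intro s
    let Δ : Eqn L P ⊕ M → L.Formula (M ⊕ P) := Sum.elim
      (fun e => (diagramFormula P e).relabel Sum.inr)
      fun m => (Term.var (Sum.inl m)).equal (Term.var (Sum.inr (MP m)))
    -- The elements of `P` are quantified away, so that `ψ` has parameters in `M` alone; it holds in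
    -- `P'`, and `transfer` carries it to `N'`.
    obtain ⟨ψ, hψ⟩ := exists_formula_exists.{u, v, max u v w}
      (Formula.iInf fun i : s.toRight => Δ i)
    have h₁ : ψ.Realize (g ∘ MP) := by
      rw [hψ]
      refine ⟨g, ?_⟩
      rw [Formula.realize_iInf]
      rintro ⟨e | m, -⟩
      · simp only [Δ, Sum.elim_inl, Formula.realize_relabel, Sum.elim_comp_inr,
          realize_diagramFormula]
        exact (holds_embedding (a := id) g).symm
      · simp [Δ]
    have h₂ : ψ.Realize (f ∘ MN) := by
      refine (hT.transfer hV (fun e => ?_) ψ).1 h₁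
      rw [holds_embedding, holds_embedding]
      have h := holds_embedding (a := id) (e := e) MP
      have h' := holds_embedding (a := id) (e := e) MN
      exact h.trans h'.symm
    obtain ⟨b, hb⟩ := (hψ N' _).1 h₂
    rw [Formula.realize_iInf] at hb
    have := model_theoryOf (hT.mem hV N')
    refine ⟨Theory.ModelType.of _ N', Sum.elim f b, ?_⟩
    rintro (e | i) hi
    · simp only [Γ, Sum.elim_inl, Formula.realize_relabel, realize_diagramFormula]
      exact (holds_embedding (a := id) f).symm
    · have := hb ⟨i, by simpa using hi⟩
      rcases i with e | m
      · exact Formula.realize_relabel.2 ((Formula.realize_relabel (φ := diagramFormula P e)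
          (g := Sum.inr) (v := Sum.elim (f ∘ MN) b)).1 this)
      · exact Formula.realize_equal.2 (Formula.realize_equal.1 this))
  obtain ⟨h, hh⟩ := exists_embedding_of_holds_id (M := N) (b := a ∘ Sum.inl) fun e =>
    realize_diagramFormula.1 (Formula.realize_relabel.1 (ha (.inl e)))
  obtain ⟨k, hk⟩ := exists_embedding_of_holds_id (M := P) (b := a ∘ Sum.inr) fun e =>
    realize_diagramFormula.1 (Formula.realize_relabel.1 (ha (.inr (.inl e))))
  refine ⟨⟨Q, inferInstance⟩, h, k, IsVariety.mem_of_model.{u, v, w} hV _ Q.is_model, ?_⟩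
  ext m
  have := ha (.inr (.inr m))
  simp only [Γ, Sum.elim_inr, Formula.realize_equal, Term.realize_var] at this
  simp [hh, hk, this]

end ModelCompletion

/-! ### Finite presentations -/

theorem finitelyPresented_iff [L.IsAlgebraic] {V : Set (Bundled.{w} L.Structure)} {A : Type w}
    [L.Structure A] : FinitelyPresented V A ↔
      ∃ (n : ℕ) (E : Set (Eqn L (Fin n))) (a : Fin n → A), E.Finite ∧
        Substructure.closure L (Set.range a) = ⊤ ∧ Sat E a ∧
        ∀ e, Holds a e → Entails V E e := by
  constructor
  · rintro ⟨n, φ, a, hφ, ha, hφa, h⟩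
    obtain ⟨E, hE, hφE⟩ := hφ.exists_sat
    refine ⟨n, E, a, hE, ha, (hφE A a).1 hφa, fun e he B hB b hb => ?_⟩
    obtain ⟨f, hf⟩ := h B hB b ((hφE B b).2 hb)
    have hfb : f ∘ a = b := funext hf
    exact hfb ▸ he.hom f
  · rintro ⟨n, E, a, hE, ha, hEa, h⟩
    refine ⟨n, conj hE, a, isEqConj_conj hE, ha, (realize_conj hE).2 hEa, fun B hB b hb => ?_⟩
    exact exists_hom_of_holds ha fun e he => h e he B hB b ((realize_conj hE).1 hb)

/-- A presentation by the generators `c` extends to one by the generators `c` and further elements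
`x`. -/
theorem exists_presentation_sum {V : Set (Bundled.{w} L.Structure)} {A : Type y}
    [L.Structure A] {m n : ℕ} {E : Set (Eqn L (Fin m))} (hE : E.Finite) {c : Fin m → A}
    (hc : Substructure.closure L (Set.range c) = ⊤) (hEc : Sat E c)
    (h : ∀ e, Holds c e → Entails V E e) (x : Fin n → A) :
    ∃ G : Set (Eqn L (Fin n ⊕ Fin m)), G.Finite ∧ Sat G (Sum.elim x c) ∧
      ∀ e, Holds (Sum.elim x c) e → Entails V G e := by
  have ht : ∀ i, ∃ t : L.Term (Fin m), t.realize c = x i := fun i =>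
    exists_term_of_mem_closure (hc ▸ Substructure.mem_top (x i))
  choose t ht using ht
  -- Each further generator is defined by an equation with a term that represents it.
  refine ⟨Eqn.map Sum.inr '' E ∪
    Set.range fun i => (Term.var (Sum.inl i), (t i).relabel Sum.inr),
    (hE.image _).union (Set.finite_range _), ?_, ?_⟩
  · rw [sat_union, sat_map, Sum.elim_comp_inr]
    refine ⟨hEc, ?_⟩
    rintro _ ⟨i, rfl⟩
    simp [Holds, ht]
  · intro e he B hB b hb
    rw [sat_union, sat_map] at hb
    let σ : Fin n ⊕ Fin m → L.Term (Fin m) := Sum.elim t Term.var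
    have key := h (e.subst σ) (by
      rw [holds_subst]
      convert he using 1
      funext i
      rcases i with i | i <;> simp [σ, ht]) B hB _ hb.1
    rw [holds_subst] at key
    convert key using 1
    funext i
    rcases i with i | i
    · have := hb.2 _ ⟨i, rfl⟩
      simpa [Holds, σ] using this
    · rfl

/-- Being finitely presented does not depend on the choice of a finite generating tuple. -/
theorem exists_presentation_of_generators [L.IsAlgebraic] {V : Set (Bundled.{w} L.Structure)}
    {A : Type w} [L.Structure A] (hA : FinitelyPresented V A) {n : ℕ} {x : Fin n → A}
    (hx : Substructure.closure L (Set.range x) = ⊤) :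
    ∃ D : Set (Eqn L (Fin n)), D.Finite ∧ Sat D x ∧ ∀ e, Holds x e → Entails V D e := by
  obtain ⟨m, E, c, hE, hc, hEc, h⟩ := finitelyPresented_iff.1 hA
  obtain ⟨G, hG, hGx, hGe⟩ := exists_presentation_sum hE hc hEc h x
  have ht : ∀ j, ∃ t : L.Term (Fin n), t.realize x = c j := fun j =>
    exists_term_of_mem_closure (hx ▸ Substructure.mem_top (c j))
  choose t ht using ht
  let σ : Fin n ⊕ Fin m → L.Term (Fin n) := Sum.elim Term.var t
  have hσ : (fun i => (σ i).realize x) = Sum.elim x c := by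
    funext i
    rcases i with i | i <;> simp [σ, ht]
  refine ⟨Eqn.subst σ '' G, hG.image _, by rwa [sat_subst, hσ], fun e he B hB b hb => ?_⟩
  rw [sat_subst] at hb
  have := hGe (e.map Sum.inl) (by simpa using he) B hB _ hb
  rwa [holds_map] at this

/-! ### Coherence from a model completion -/

section ModelCompletion

variable [L.IsAlgebraic] [Nonempty L.Constants] {V : Set (Bundled.{max u v w} L.Structure)}
  {T : L.Theory}

/-- Let `ψ` say that a tuple extends to a solution of the presentation `G` of `A` on the generators
`x`, `c`. If a finite set `D` of equations of `x` implies `ψ` over `T`, then `D` presents the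
subalgebra: any tuple in `V` satisfying `D` extends, in a model of `T`, to a solution of `G`, and so
satisfies every equation of `x`. -/
theorem IsModelCompletion.coherent (hV : IsVariety V) (hE : HasEDPC V)
    (hT : IsModelCompletion.{u, v, max u v w} (theoryOf V) T) : Coherent V := by
  classical
  intro A hA hfp S hS
  obtain ⟨m, E, c, hEfin, hc, hEc, hc'⟩ := finitelyPresented_iff.1 hfp
  obtain ⟨n, x, rfl⟩ := Substructure.fg_iff_exists_fin_generating_family.1 hS
  obtain ⟨G, hG, hGx, hGe⟩ := exists_presentation_sum hEfin hc hEc hc' x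
  obtain ⟨ψ, hψ⟩ := exists_formula_exists.{u, v, max u v w} (conj hG)
  simp only [realize_conj] at hψ
  have key : ∃ D : Set (Eqn L (Fin n)), D ⊆ {e | Holds x e} ∧ D.Finite ∧
      ∀ (N : Theory.ModelType.{u, v, max u v w} T) (a : Fin n → N), Sat D a → ψ.Realize a := by
    by_contra hn
    push Not at hn
    -- Otherwise some tuple `a` in a model of `T` satisfies all equations of `x` but not `ψ`.
    obtain ⟨N, a, ha⟩ := exists_realize_of_finset.{u, v, max u v w, 0} (T := T)
      (ι := Option {e : Eqn L (Fin n) | Holds x e})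
      (fun o => o.elim ψ.not fun d => d.1.1.equal d.1.2) (by
        intro s
        obtain ⟨N, a, ha, hne⟩ := hn
          (Subtype.val '' (s.eraseNone : Set {e : Eqn L (Fin n) | Holds x e}))
          (by rintro _ ⟨d, -, rfl⟩; exact d.2) (Set.toFinite _)
        refine ⟨N, a, ?_⟩
        rintro (_ | d) hd
        · exact hne
        · exact Formula.realize_equal.2 (ha d ⟨d, by simpa using hd, rfl⟩))
    have hxa : ∀ e, Holds x e → Holds a e := fun e he =>
      Formula.realize_equal.1 (ha (some ⟨e, he⟩))
    obtain ⟨F, hF, g, -, hg⟩ := exists_presented.{u, v, max u v w, 0} hV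
      (Eqn.map Sum.inl '' {e : Eqn L (Fin n) | Holds a e} ∪ G)
    have hga : ∀ e : Eqn L (Fin n), Holds (g ∘ Sum.inl) e ↔ Holds a e := by
      intro e
      rw [← holds_map, hg]
      constructor
      · intro h
        obtain ⟨E', hE', hfin, he⟩ := Entails.exists_finite_image.{u, v, max u v w, 0} hV h
        -- Conservativity of `G`: the implication `E' → e` holds at `x`, since `c` witnesses `G` in
        -- `A`; being a set of equations, it then holds at `a`.
        obtain ⟨K, -, hK⟩ := hE.exists_imp hV hfin (Set.finite_singleton e)
        have hKx : Sat K x := by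
          refine (hK A hA x).2 fun B hB f hf => ?_
          rw [sat_singleton]
          have := he B hB (f ∘ Sum.elim x c) (by
            rw [sat_union, sat_map, Function.comp_assoc, Sum.elim_comp_inl]
            exact ⟨hf, hGx.hom f⟩)
          rwa [holds_map, Function.comp_assoc, Sum.elim_comp_inl] at this
        have hKa : Sat K a := fun k hk => hxa k (hKx k hk)
        have := (hK _ (hT.mem hV N) a).1 hKa _ (hT.mem hV N) (Hom.id L N) hE'
        rwa [sat_singleton] at this
      · exact fun h => Entails.of_mem (.inl ⟨e, h, rfl⟩)
    obtain ⟨N', ⟨f⟩⟩ := hT.exists_embedding hF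
    refine ha none ((hT.transfer hV (a₁ := f ∘ g ∘ Sum.inl) (fun e => ?_) ψ).1
      ((hψ N' _).2 ⟨f ∘ g ∘ Sum.inr, ?_⟩))
    · rw [holds_embedding, hga]
    · have : Sum.elim (f ∘ g ∘ Sum.inl) (f ∘ g ∘ Sum.inr) = f ∘ g := by
        funext i
        rcases i with i | i <;> rfl
      rw [this, sat_embedding]
      exact fun d hd => (hg d).2 (Entails.of_mem (.inr hd))
  obtain ⟨D, hDx, hD, hDψ⟩ := key
  refine finitelyPresented_iff.2 ⟨n, D, gens L x, hD, closure_range_gens x, ?_, ?_⟩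
  · rw [sat_gens]
    exact hDx
  · intro e he B hB b hb
    rw [holds_gens] at he
    obtain ⟨N, ⟨f⟩⟩ := hT.exists_embedding hB
    obtain ⟨z, hz⟩ := (hψ N _).1 (hDψ N (f ∘ b) ((sat_embedding f).2 hb))
    have := hGe (e.map Sum.inl) (by simpa using he) _ (hT.mem hV N) _ hz
    rwa [holds_map, Sum.elim_comp_inl, holds_embedding] at this

end ModelCompletion

/-! ### Compact intersections -/

/-- The quotient of a free algebra by the congruence generated by `E` is the algebra presented by
`E`. This translates compact congruences into finite sets of equations. -/
theorem congruenceGen_iff_entails [L.IsAlgebraic] {V : Set (Bundled.{w} L.Structure)}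
    (hV : IsVariety V) {X : Type*} {F : Bundled.{w} L.Structure} (hF : F ∈ V) {g : X → F}
    (hgen : Substructure.closure L (Set.range g) = ⊤)
    (hg : ∀ e, Holds g e ↔ Entails V ∅ e) (E : Set (Eqn L X)) (e : Eqn L X) :
    congruenceGen L ((fun d : Eqn L X => (d.1.realize g, d.2.realize g)) '' E)
      (e.1.realize g) (e.2.realize g) ↔ Entails V E e := by
  constructor
  · intro h A hA a ha
    obtain ⟨f, hf⟩ := exists_hom_of_holds hgen (b := a) fun e he => (hg e).1 he A hA a sat_empty
    have hfa : f ∘ g = a := funext hf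
    subst hfa
    have hle := congruenceGen_le (L := L)
      (S := (fun d : Eqn L X => (d.1.realize g, d.2.realize g)) '' E) (isCongruence_ker f) (by
        rintro _ ⟨d, hd, rfl⟩
        have := ha d hd
        simpa only [Holds, HomClass.realize_term, Setoid.ker_def] using this)
    have := hle h
    simpa only [Holds, HomClass.realize_term, Setoid.ker_def] using this
  · intro h
    obtain ⟨B, hB, f, -, hf⟩ := exists_quotient hV hF (isCongruence_congruenceGen (L := L)
      ((fun d : Eqn L X => (d.1.realize g, d.2.realize g)) '' E))
    rw [← hf]
    have := h B hB (f ∘ g) fun d hd => by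
      simp only [Holds, HomClass.realize_term]
      rw [hf]
      exact congruenceGen_of_mem (L := L) (Set.mem_image_of_mem _ hd)
    simpa only [Holds, HomClass.realize_term] using this

theorem realize_congr {X M : Type*} [DecidableEq X] [L.Structure M] {t : L.Term X} {a b : X → M}
    (h : ∀ i ∈ t.varFinset, a i = b i) : t.realize a = t.realize b :=
  (Term.realize_restrictVar (f := Subtype.val) (v := a) a fun _ => rfl).symm.trans
    (Term.realize_restrictVar (f := Subtype.val) b fun i => h i i.2)

/-- Under the compact intersection property, any two finite sets of equations have a disjunction
with respect to entailment of equations in one further variable. -/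
theorem CompactIntersectionProperty.exists_inter [L.IsAlgebraic] [Nonempty L.Constants]
    {V : Set (Bundled.{max u v w} L.Structure)} (hV : IsVariety V)
    (hC : CompactIntersectionProperty V) {n : ℕ} {E₁ E₂ : Set (Eqn L (Fin n))}
    (h₁ : E₁.Finite) (h₂ : E₂.Finite) :
    ∃ D : Set (Eqn L (Fin n)), D.Finite ∧ (∀ d ∈ D, Entails V E₁ d ∧ Entails V E₂ d) ∧
      ∀ e : Eqn L (Fin (n + 1)), Entails V (Eqn.map Fin.castSucc '' E₁) e →
        Entails V (Eqn.map Fin.castSucc '' E₂) e → Entails V (Eqn.map Fin.castSucc '' D) e := by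
  classical
  -- Infinitely many spare variables, so that one remains unused by whatever finite generating set
  -- the intersection turns out to have.
  obtain ⟨F, hF, g, hgen, hg⟩ := exists_presented.{u, v, w, 0} hV (∅ : Set (Eqn L (Fin n ⊕ ℕ)))
  have hcong := congruenceGen_iff_entails hV hF hgen hg
  let ev : Eqn L (Fin n ⊕ ℕ) → F × F := fun d => (d.1.realize g, d.2.realize g)
  obtain ⟨S, hS, hinter⟩ := hC F hF
    (congruenceGen L (ev '' (Eqn.map Sum.inl '' E₁)))
    (congruenceGen L (ev '' (Eqn.map Sum.inl '' E₂)))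
    ⟨_, (h₁.image _).image _, rfl⟩ ⟨_, (h₂.image _).image _, rfl⟩
  have hsurj : Function.Surjective ev := by
    rintro ⟨p, q⟩
    obtain ⟨s, rfl⟩ := exists_term_of_mem_closure (hgen ▸ Substructure.mem_top p)
    obtain ⟨t, rfl⟩ := exists_term_of_mem_closure (hgen ▸ Substructure.mem_top q)
    exact ⟨(s, t), rfl⟩
  obtain ⟨R, hR, rfl⟩ : ∃ R : Set (Eqn L (Fin n ⊕ ℕ)), R.Finite ∧ ev '' R = S :=
    ⟨Function.surjInv hsurj '' S, hS.image _, by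
      rw [Set.image_image]
      simp [Function.surjInv_eq hsurj]⟩
  have hmem : ∀ e, Entails V R e ↔
      Entails V (Eqn.map Sum.inl '' E₁) e ∧ Entails V (Eqn.map Sum.inl '' E₂) e := by
    intro e
    rw [← hcong, ← hcong, ← hcong]
    change congruenceGen L (ev '' R) _ _ ↔ _
    rw [← hinter]
    rfl
  let c : L.Constants := Classical.arbitrary _
  -- The generators found may contain spare variables; a constant symbol replaces them.
  let σ : Fin n ⊕ ℕ → L.Term (Fin n) := Sum.elim Term.var fun _ => c.term
  refine ⟨Eqn.subst σ '' R, hR.image _, ?_, ?_⟩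
  · rintro _ ⟨r, hr, rfl⟩
    have := (hmem r).1 (Entails.of_mem hr)
    constructor
    · intro A hA a ha
      rw [holds_subst]
      exact this.1 A hA _ (by rw [sat_map]; exact ha)
    · intro A hA a ha
      rw [holds_subst]
      exact this.2 A hA _ (by rw [sat_map]; exact ha)
  · intro e he₁ he₂ A hA a ha
    have hfin : (⋃ r ∈ R, {j : ℕ | Sum.inr j ∈ r.1.varFinset ∪ r.2.varFinset}).Finite :=
      hR.biUnion fun r _ => (Finset.finite_toSet (r.1.varFinset ∪ r.2.varFinset)).preimage
        Sum.inr_injective.injOn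
    obtain ⟨j, hj⟩ := hfin.exists_notMem
    simp only [Set.mem_iUnion, not_exists] at hj
    let τ : Fin (n + 1) → Fin n ⊕ ℕ := Fin.lastCases (Sum.inr j) Sum.inl
    have hτ : τ ∘ Fin.castSucc = Sum.inl := by
      funext i
      simp [τ]
    have hτe : ∀ E : Set (Eqn L (Fin n)), Entails V (Eqn.map Fin.castSucc '' E) e →
        Entails V (Eqn.map Sum.inl '' E) (e.map τ) := by
      intro E h B hB b hb
      rw [sat_map] at hb
      rw [holds_map]
      refine h B hB _ ?_
      rw [sat_map, Function.comp_assoc, hτ]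
      exact hb
    have hRe := (hmem (e.map τ)).2 ⟨hτe E₁ he₁, hτe E₂ he₂⟩
    -- The unused variable `j` plays the role of the last variable of `e`; the other spare variables
    -- take the constant's value, as under `σ`.
    let b : Fin n ⊕ ℕ → A :=
      Sum.elim (a ∘ Fin.castSucc) fun k => if k = j then a (Fin.last n) else (c : A)
    have hb : b ∘ τ = a := by
      funext i
      refine Fin.lastCases ?_ (fun i => ?_) i <;> simp [b, τ]
    have := hRe A hA b (by
      intro r hr
      rw [sat_map, sat_subst] at ha
      have hne : ∀ i ∈ r.1.varFinset ∪ r.2.varFinset,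
          (σ i).realize (a ∘ Fin.castSucc) = b i := by
        rintro (i | k) hk
        · rfl
        · have : k ≠ j := by
            rintro rfl
            exact hj r hr hk
          simp [σ, b, this]
      have h := ha r hr
      unfold Holds at h ⊢
      rwa [realize_congr fun i hi => hne i (Finset.mem_union_left _ hi),
        realize_congr fun i hi => hne i (Finset.mem_union_right _ hi)] at h)
    rwa [holds_map, hb] at this

/-! ### The equational variable restriction property from a model completion -/

section ModelCompletion

variable [L.IsAlgebraic] [Nonempty L.Constants] {V : Set (Bundled.{max u v w} L.Structure)}
  {T : L.Theory}

theorem CompactIntersectionProperty.exists_inter_finset (hV : IsVariety V)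
    (hC : CompactIntersectionProperty V) {n : ℕ} {G : Set (Eqn L (Fin (n + 1)))}
    {ι : Type*} {s : Finset ι} (hs : s.Nonempty) (E : ι → Set (Eqn L (Fin n)))
    (hE : ∀ i ∈ s, (E i).Finite ∧ ∀ e ∈ G, Entails V (Eqn.map Fin.castSucc '' E i) e) :
    ∃ D : Set (Eqn L (Fin n)), D.Finite ∧
      (∀ e ∈ G, Entails V (Eqn.map Fin.castSucc '' D) e) ∧
      ∀ i ∈ s, ∀ d ∈ D, Entails V (E i) d := by
  classical
  induction hs using Finset.Nonempty.cons_induction with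
  | singleton i =>
    obtain ⟨h₁, h₂⟩ := hE i (by simp)
    refine ⟨E i, h₁, h₂, fun j hj d hd => ?_⟩
    obtain rfl := Finset.mem_singleton.1 hj
    exact Entails.of_mem hd
  | cons i s hi hs ih =>
    obtain ⟨D, hD, hDG, hDE⟩ := ih fun j hj => hE j (Finset.mem_cons_of_mem hj)
    obtain ⟨h₁, h₂⟩ := hE i (Finset.mem_cons_self _ _)
    obtain ⟨D', hD', h, h'⟩ := hC.exists_inter.{u, v, w} hV h₁ hD
    refine ⟨D', hD', fun e he => h' e (h₂ e he) (hDG e he), fun j hj d hd => ?_⟩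
    rcases Finset.mem_cons.1 hj with rfl | hj
    · exact (h d hd).1
    · exact fun A hA a ha => (h d hd).2 A hA a fun d' hd' => hDE j hj d' hd' A hA a ha

/-- Over `T`, the formula `∀ y, γ` is equivalent to a finite disjunction of sets of equations that
entail `γ`; compact intersections merge them into one set that still entails `γ`. -/
theorem IsModelCompletion.eqVarRestriction (hV : IsVariety V)
    (hC : CompactIntersectionProperty V)
    (hT : IsModelCompletion.{u, v, max u v w} (theoryOf V) T) : EqVarRestriction V := by
  classical
  intro n γ hγ
  obtain ⟨G, hG, hγG⟩ := hγ.exists_sat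
  let S := {E : Set (Eqn L (Fin n)) //
    E.Finite ∧ ∀ e ∈ G, Entails V (Eqn.map Fin.castSucc '' E) e}
  obtain ⟨ψ, hψ⟩ := exists_formula_exists_last.{u, v, max u v w} (conj hG).not
  have hψ' : ∀ (N : Type (max u v w)) [L.Structure N] [Nonempty N] (a : Fin n → N),
      ψ.not.Realize a ↔ ∀ b : Fin (n + 1) → N, b ∘ Fin.castSucc = a → Sat G b := by
    intro N _ _ a
    rw [Formula.realize_not, hψ]
    simp
  have hS : ∀ (E : Set (Eqn L (Fin n))), (∀ e ∈ G, Entails V (Eqn.map Fin.castSucc '' E) e) →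
      ∀ (N : Theory.ModelType.{u, v, max u v w} T) (a : Fin n → N),
      Sat E a → ψ.not.Realize a := by
    intro E hE N a ha
    rw [hψ']
    rintro b rfl e he
    exact hE e he _ (hT.mem hV N) b (by rwa [sat_map])
  have key : ∃ s : Finset S, ∀ (N : Theory.ModelType.{u, v, max u v w} T) (a : Fin n → N),
      ψ.not.Realize a → ∃ E ∈ s, Sat E.1 a := by
    by_contra hn
    push Not at hn
    obtain ⟨N, a, ha⟩ := exists_realize_of_finset.{u, v, max u v w, 0} (T := T)
      (fun o : Option S => o.elim ψ.not fun E => (conj E.2.1).not) (by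
        intro s
        obtain ⟨N, a, ha, hne⟩ := hn s.eraseNone
        refine ⟨N, a, ?_⟩
        rintro (_ | E) hE
        · exact ha
        · rw [Option.elim_some, Formula.realize_not, realize_conj]
          exact hne E (by simpa using hE))
    let Θ : Set (Eqn L (Fin n)) := {e | Holds a e}
    -- Adjoin a free element `y` to the equations of `a`. Since `∀ y, γ` transfers to a model above
    -- `F`, it holds at this free element, so the equations of `a` entail `γ`.
    obtain ⟨F, hF, g, -, hg⟩ := exists_presented.{u, v, max u v w, 0} hV
      (Eqn.map Fin.castSucc '' Θ)
    have hga : ∀ e : Eqn L (Fin n), Holds (g ∘ Fin.castSucc) e ↔ Holds a e := by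
      intro e
      rw [← holds_map, hg]
      constructor
      · intro h
        have hsnoc : (Fin.snoc a (Classical.arbitrary N) : Fin (n + 1) → N) ∘ Fin.castSucc = a := by
          funext i
          simp
        have := h _ (hT.mem hV N) (Fin.snoc a (Classical.arbitrary N)) (by
          rw [sat_map, hsnoc]
          exact fun d hd => hd)
        rwa [holds_map, hsnoc] at this
      · exact fun h => Entails.of_mem ⟨e, h, rfl⟩
    obtain ⟨N', ⟨f⟩⟩ := hT.exists_embedding hF
    have h₁ : ψ.not.Realize (f ∘ g ∘ Fin.castSucc) := by
      refine (hT.transfer hV (fun e => ?_) _).2 (ha none)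
      rw [holds_embedding, hga]
    have h₂ : Sat G g := (sat_embedding f).1 ((hψ' N' _).1 h₁ _ rfl)
    have h₃ : ∀ e ∈ G, ∃ E ⊆ Θ, E.Finite ∧ Entails V (Eqn.map Fin.castSucc '' E) e := by
      intro e he
      have := (hg e).1 (h₂ e he)
      rw [← Set.union_empty (Eqn.map Fin.castSucc '' Θ)] at this
      simpa only [Set.union_empty] using Entails.exists_finite_image.{u, v, max u v w, 0} hV this
    choose! D hDΘ hDfin hDe using h₃
    -- The premises for the finitely many equations of `G` form a member of `S` that holds at `a`,
    -- against the choice of `a`.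
    have := ha (some ⟨⋃ e ∈ G, D e, hG.biUnion hDfin, fun e he => (hDe e he).mono
      (Set.image_mono (Set.subset_biUnion_of_mem (u := D) he))⟩)
    rw [Option.elim_some, Formula.realize_not, realize_conj] at this
    refine this fun d hd => ?_
    simp only [Set.mem_iUnion] at hd
    obtain ⟨e, he, hd⟩ := hd
    exact hDΘ e he hd
  obtain ⟨s, hs⟩ := key
  have hφ : ∀ φ : L.Formula (Fin n), IsEqConj φ → Valid V ((weaken φ).imp γ) →
      ∀ A ∈ V, ∀ a : Fin n → A, φ.Realize a →
      ∃ (N : Theory.ModelType.{u, v, max u v w} T) (f : A ↪[L] N), ∃ E ∈ s, Sat E.1 (f ∘ a) := by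
    intro φ hφ hval A hA a ha
    obtain ⟨E, -, hφE⟩ := hφ.exists_sat
    obtain ⟨N, ⟨f⟩⟩ := hT.exists_embedding hA
    refine ⟨N, f, hs N _ (hS E (fun e he B hB b hb => ?_) N _ ?_)⟩
    · have := hval B hB b
      rw [Formula.realize_imp, realize_weaken, hγG, hφE] at this
      exact this (by rwa [sat_map] at hb) e he
    · rw [sat_embedding]
      exact (hφE A a).1 ha
  -- An empty disjunction means that no conjunction of equations satisfiable in `V` entails `γ`;
  -- this is where `⊥` is needed.
  rcases s.eq_empty_or_nonempty with rfl | hne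
  · refine ⟨⊥, .inl rfl, fun A _ a => ?_, fun φ hφc hval A hA a => ?_⟩
    · rw [Formula.realize_imp, realize_weaken]
      exact fun h => h.elim
    · rw [Formula.realize_imp]
      intro h
      obtain ⟨N, f, E, hE, -⟩ := hφ φ hφc hval A hA a h
      simp at hE
  · obtain ⟨D, hD, hDG, hDs⟩ := hC.exists_inter_finset hV hne (fun E => E.1) fun E _ => E.2
    refine ⟨conj hD, .inr (isEqConj_conj hD), fun A hA a => ?_, fun φ hφc hval A hA a => ?_⟩
    · rw [Formula.realize_imp, realize_weaken, realize_conj, hγG]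
      exact fun h e he => hDG e he A hA a (by rwa [sat_map])
    · rw [Formula.realize_imp, realize_conj]
      intro h
      obtain ⟨N, f, E, hE, hsat⟩ := hφ φ hφc hval A hA a h
      exact fun d hd => hDs E hE d hd A hA a ((sat_embedding f).1 hsat)

end ModelCompletion

/-! ### Quantifier-free formulas -/

section QuantifierFree

variable {α : Type*} {n : ℕ}

theorem isQF_foldr_inf {l : List (L.BoundedFormula α n)} (h : ∀ φ ∈ l, φ.IsQF) :
    (l.foldr (· ⊓ ·) ⊤).IsQF := by
  induction l with
  | nil => exact BoundedFormula.IsQF.top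
  | cons φ l ih =>
    exact (h φ (by simp)).inf (ih fun ψ hψ => h ψ (by simp [hψ]))

theorem isQF_foldr_sup {l : List (L.BoundedFormula α n)} (h : ∀ φ ∈ l, φ.IsQF) :
    (l.foldr (· ⊔ ·) ⊥).IsQF := by
  induction l with
  | nil => exact BoundedFormula.isQF_bot
  | cons φ l ih =>
    exact (h φ (by simp)).sup (ih fun ψ hψ => h ψ (by simp [hψ]))

theorem isQF_iInf {β : Type*} [Finite β] {f : β → L.Formula α} (h : ∀ i, (f i).IsQF) :
    (Formula.iInf f).IsQF := by
  refine isQF_foldr_inf fun φ hφ => ?_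
  obtain ⟨i, -, rfl⟩ := List.mem_map.1 hφ
  exact h i

theorem isQF_iSup {β : Type*} [Finite β] {f : β → L.Formula α} (h : ∀ i, (f i).IsQF) :
    (Formula.iSup f).IsQF := by
  refine isQF_foldr_sup fun φ hφ => ?_
  obtain ⟨i, -, rfl⟩ := List.mem_map.1 hφ
  exact h i

theorem IsEqConj.isQF {φ : L.Formula α} (h : IsEqConj φ) : φ.IsQF := by
  obtain ⟨E, rfl⟩ := h
  refine isQF_foldr_inf fun φ hφ => ?_
  obtain ⟨e, -, rfl⟩ := List.mem_map.1 hφ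
  exact (BoundedFormula.IsAtomic.equal _ _).isQF

theorem realize_embedding_of_isQF {M N : Type*} [L.Structure M] [L.Structure N]
    {φ : L.Formula α} (h : φ.IsQF) (f : M ↪[L] N) {a : α → M} :
    φ.Realize (f ∘ a) ↔ φ.Realize a := by
  have := h.realize_embedding f (v := a) (xs := default)
  rwa [Subsingleton.elim (f ∘ default : Fin 0 → N) default] at this

end QuantifierFree

/-- A finite system of equations and negated equations. -/
structure LitSys (L : FirstOrder.Language.{u, v}) (α : Type x) where
  /-- The equations. -/
  pos : Set (Eqn L α)
  /-- The equations that are negated. -/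
  neg : Set (Eqn L α)
  pos_finite : pos.Finite
  neg_finite : neg.Finite

namespace LitSys

variable {α : Type x} {M : Type*} [L.Structure M]

/-- The assignment `a` satisfies the system `d`. -/
def Sat (d : LitSys L α) (a : α → M) : Prop := UnivAlg.Sat d.pos a ∧ ∀ e ∈ d.neg, ¬ Holds a e

theorem sat_embedding {N : Type*} [L.Structure N] {d : LitSys L α} {a : α → M} (f : M ↪[L] N) :
    d.Sat (f ∘ a) ↔ d.Sat a := by
  simp only [Sat, UnivAlg.sat_embedding, holds_embedding]

/-- The formula expressing a system. -/
noncomputable def formula (d : LitSys L α) : L.Formula α :=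
  haveI := d.neg_finite.to_subtype
  conj d.pos_finite ⊓ Formula.iInf fun e : d.neg => (e.1.1.equal e.1.2).not

theorem realize_formula {d : LitSys L α} {a : α → M} : d.formula.Realize a ↔ d.Sat a := by
  have := d.neg_finite.to_subtype
  rw [formula, Formula.realize_inf, realize_conj, Formula.realize_iInf]
  simp only [Formula.realize_not, Formula.realize_equal, Sat]
  exact and_congr_right fun _ => Subtype.forall

/-- De Morgan and distributivity: the negation of a system is a disjunction of single literals `p
e`, `q e`, each of which is then conjoined with the systems of `D'`. -/
theorem exists_neg (D : Set (LitSys L α)) (hD : D.Finite) : ∃ D' : Set (LitSys L α), D'.Finite ∧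
    ∀ (M : Type w) [L.Structure M] (a : α → M),
      (∃ d ∈ D', d.Sat a) ↔ ¬ ∃ d ∈ D, d.Sat a := by
  induction D, hD using Set.Finite.induction_on with
  | empty =>
    refine ⟨{⟨∅, ∅, Set.finite_empty, Set.finite_empty⟩}, Set.finite_singleton _, fun M _ a => ?_⟩
    simp [Sat]
  | @insert d D _ _ ih =>
    obtain ⟨D', hD', h⟩ := ih
    let p (e : Eqn L α) : LitSys L α := ⟨{e}, ∅, Set.finite_singleton _, Set.finite_empty⟩
    let q (e : Eqn L α) : LitSys L α := ⟨∅, {e}, Set.finite_empty, Set.finite_singleton _⟩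
    let r (c d : LitSys L α) : LitSys L α :=
      ⟨c.pos ∪ d.pos, c.neg ∪ d.neg, c.pos_finite.union d.pos_finite,
        c.neg_finite.union d.neg_finite⟩
    refine ⟨Set.image2 r (q '' d.pos ∪ p '' d.neg) D',
      ((d.pos_finite.image _).union (d.neg_finite.image _)).image2 _ hD', fun M _ a => ?_⟩
    have hp : ∀ e, (p e).Sat a ↔ Holds a e := fun e => by simp [p, Sat]
    have hq : ∀ e, (q e).Sat a ↔ ¬ Holds a e := fun e => by simp [q, Sat, -Prod.forall]
    have hr : ∀ c d, (r c d).Sat a ↔ c.Sat a ∧ d.Sat a := fun c d => by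
      simp only [r, Sat, sat_union, Set.mem_union, or_imp, forall_and]
      tauto
    have hd : (∃ c ∈ q '' d.pos ∪ p '' d.neg, c.Sat a) ↔ ¬ d.Sat a := by
      simp only [Set.mem_union, or_and_right, exists_or, Set.exists_mem_image, hp, hq]
      simp only [Sat, UnivAlg.Sat, not_and_or, not_forall, not_not, exists_prop]
    calc (∃ c ∈ Set.image2 r (q '' d.pos ∪ p '' d.neg) D', c.Sat a)
        ↔ (∃ c ∈ q '' d.pos ∪ p '' d.neg, c.Sat a) ∧ ∃ d ∈ D', d.Sat a := by
          simp only [Set.exists_mem_image2, hr]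
          constructor
          · rintro ⟨c, hc, d, hd, h₁, h₂⟩
            exact ⟨⟨c, hc, h₁⟩, d, hd, h₂⟩
          · rintro ⟨⟨c, hc, h₁⟩, d, hd, h₂⟩
            exact ⟨c, hc, d, hd, h₁, h₂⟩
      _ ↔ ¬ ∃ c ∈ insert d D, c.Sat a := by
          rw [hd, h, Set.exists_mem_insert, not_or]

/-- Disjunctive normal form. -/
theorem exists_dnf [L.IsAlgebraic] {φ : L.Formula α} (hφ : φ.IsQF) :
    ∃ D : Set (LitSys L α), D.Finite ∧
      ∀ (M : Type w) [L.Structure M] (a : α → M), φ.Realize a ↔ ∃ d ∈ D, d.Sat a := by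
  unfold Formula at φ
  induction hφ with
  | falsum => exact ⟨∅, Set.finite_empty, fun M _ a => by simp [Formula.Realize]; exact id⟩
  | of_isAtomic h =>
    cases h with
    | equal t₁ t₂ =>
      let σ : α ⊕ Fin 0 → α := Sum.elim id fun i => i.elim0
      refine ⟨{⟨{(t₁.relabel σ, t₂.relabel σ)}, ∅, Set.finite_singleton _, Set.finite_empty⟩},
        Set.finite_singleton _, fun M _ a => ?_⟩
      have : a ∘ σ = Sum.elim a default := by
        funext i
        rcases i with i | i
        · rfl
        · exact i.elim0
      simp [Sat, Formula.Realize, Holds, this]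
    | rel R => exact isEmptyElim R
  | imp _ _ ih₁ ih₂ =>
    obtain ⟨D₁, hD₁, h₁⟩ := ih₁
    obtain ⟨D₂, hD₂, h₂⟩ := ih₂
    obtain ⟨D', hD', h'⟩ := exists_neg.{u, v, w} D₁ hD₁
    refine ⟨D' ∪ D₂, hD'.union hD₂, fun M _ a => ?_⟩
    rw [Formula.realize_imp, h₁, h₂, imp_iff_not_or, ← h']
    simp only [Set.mem_union, or_and_right, exists_or]

end LitSys

/-! ### Eliminating a variable -/

section Elimination

variable [L.IsAlgebraic] {V : Set (Bundled.{max u v w} L.Structure)}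

/-- Coherence: the consequences of a finite set of equations in fewer variables are finitely
based. -/
theorem Coherent.exists_restriction (hV : IsVariety V) (hC : Coherent V) {n : ℕ}
    {G : Set (Eqn L (Fin (n + 1)))} (hG : G.Finite) :
    ∃ D : Set (Eqn L (Fin n)), D.Finite ∧
      ∀ e, Entails V G (e.map Fin.castSucc) ↔ Entails V D e := by
  obtain ⟨F, hF, g, hgen, hg⟩ := exists_presented.{u, v, max u v w, 0} hV G
  have hfp : FinitelyPresented V F := finitelyPresented_iff.2
    ⟨n + 1, G, g, hG, hgen, fun e he => (hg e).2 (.of_mem he), fun e => (hg e).1⟩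
  have hS := hC F hF hfp (Substructure.closure L (Set.range (g ∘ Fin.castSucc)))
    (Substructure.fg_iff_exists_fin_generating_family.2 ⟨n, _, rfl⟩)
  obtain ⟨D, hD, hDg, hDe⟩ := exists_presentation_of_generators hS
    (closure_range_gens (g ∘ Fin.castSucc))
  refine ⟨D, hD, fun e => ?_⟩
  rw [← hg, holds_map, ← holds_gens]
  exact ⟨hDe e, fun h => h _ (hV.substructure_mem hF _) _ hDg⟩

variable [Nonempty L.Constants]

/-- The restriction given by coherence is uniform in further equations. -/
theorem HasEDPC.entails_restriction (hV : IsVariety V) (hE : HasEDPC V) {n : ℕ}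
    {G : Set (Eqn L (Fin (n + 1)))} {D : Set (Eqn L (Fin n))}
    (hD : ∀ e, Entails V G (e.map Fin.castSucc) → Entails V D e) {Θ : Set (Eqn L (Fin n))}
    {e : Eqn L (Fin n)} (h : Entails V (Eqn.map Fin.castSucc '' Θ ∪ G) (e.map Fin.castSucc)) :
    Entails V (Θ ∪ D) e := by
  obtain ⟨E, hEΘ, hfin, he⟩ := Entails.exists_finite_image.{u, v, max u v w, 0} hV h
  -- The equations `K` of `E → e` contain only the first `n` variables and follow from `G`, hence
  -- from `D`.
  obtain ⟨K, -, hK⟩ := hE.exists_imp hV hfin (Set.finite_singleton e)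
  have hDK : ∀ k ∈ K, Entails V D k := by
    intro k hk
    refine hD k fun A hA a ha => ?_
    rw [holds_map]
    refine (hK A hA _).2 (fun B hB f hf => ?_) k hk
    have := he B hB (f ∘ a) (by
      rw [sat_union, sat_map]
      exact ⟨hf, ha.hom f⟩)
    rw [holds_map] at this
    exact sat_singleton.2 this
  intro A hA a ha
  rw [sat_union] at ha
  have := (hK A hA a).1 (fun k hk => hDK k hk A hA a ha.2) A hA (Hom.id L A) (ha.1.mono hEΘ)
  rwa [sat_singleton] at this

/-- The weakest condition under which a finite set of equations entails an equation. -/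
theorem EqVarRestriction.exists_weakest (hV : IsVariety V) (hE : HasEDPC V)
    (hR : EqVarRestriction V) {n : ℕ} {G : Set (Eqn L (Fin (n + 1)))} (hG : G.Finite)
    (e : Eqn L (Fin (n + 1))) :
    ∃ π : L.Formula (Fin n), π.IsQF ∧
      (∀ A ∈ V, ∀ a : Fin (n + 1) → A, π.Realize (a ∘ Fin.castSucc) → Sat G a → Holds a e) ∧
      ∀ Θ : Set (Eqn L (Fin n)), Entails V (Eqn.map Fin.castSucc '' Θ ∪ G) e →
        ∀ A ∈ V, ∀ a : Fin n → A, Sat Θ a → π.Realize a := by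
  -- Moving `G` to the right as `G → e` leaves premises free of the last variable, as the
  -- restriction property requires.
  obtain ⟨K, hKfin, hK⟩ := hE.exists_imp hV hG (Set.finite_singleton e)
  obtain ⟨π, hπ, hπK, hπmax⟩ := hR n (conj hKfin) (isEqConj_conj hKfin)
  refine ⟨π, ?_, fun A hA a ha hGa => ?_, fun Θ hΘ A hA a ha => ?_⟩
  · rcases hπ with rfl | hπ
    · exact BoundedFormula.isQF_bot
    · exact hπ.isQF
  · have := hπK A hA a
    rw [Formula.realize_imp, realize_weaken, realize_conj, hK A hA a] at this
    exact sat_singleton.1 (this ha A hA (Hom.id L A) hGa)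
  · obtain ⟨E, hEΘ, hfin, he⟩ := Entails.exists_finite_image.{u, v, max u v w, 0} hV hΘ
    have := hπmax (conj hfin) (isEqConj_conj hfin) (fun B hB b => by
      rw [Formula.realize_imp, realize_weaken, realize_conj, realize_conj, hK B hB]
      intro hEb C hC f hf
      rw [sat_singleton]
      refine he C hC _ ?_
      rw [sat_union, sat_map]
      exact ⟨hEb.hom f, hf⟩) A hA a
    rw [Formula.realize_imp, realize_conj] at this
    exact this (ha.mono hEΘ)

/-- Over `V`, the solvability in some extension of a finite system of equations and negated
equations in one variable is a quantifier-free condition on the parameters. -/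
theorem exists_solvability_condition (hV : IsVariety V) (hE : HasEDPC V) (hC : Coherent V)
    (hA : Amalgamation V) (hR : EqVarRestriction V) {n : ℕ} (d : LitSys L (Fin (n + 1))) :
    ∃ q : L.Formula (Fin n), q.IsQF ∧
      (∀ M ∈ V, ∀ b : Fin (n + 1) → M, d.Sat b → q.Realize (b ∘ Fin.castSucc)) ∧
      ∀ M ∈ V, ∀ a : Fin n → M, q.Realize a →
        ∃ N ∈ V, ∃ (f : M ↪[L] N) (b : Fin (n + 1) → N), b ∘ Fin.castSucc = f ∘ a ∧ d.Sat b := by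
  obtain ⟨D, hDfin, hD⟩ := hC.exists_restriction hV d.pos_finite
  choose π hπqf hπ hπmax using
    fun e : d.neg => hR.exists_weakest hV hE d.pos_finite e.1
  have := d.neg_finite.to_subtype
  have hq : ∀ (M : Bundled.{max u v w} L.Structure) (a : Fin n → M),
      (conj hDfin ⊓ Formula.iInf fun e => (π e).not).Realize a ↔
        Sat D a ∧ ∀ e, ¬ (π e).Realize a := by
    intro M a
    rw [Formula.realize_inf, realize_conj, Formula.realize_iInf]
    rfl
  refine ⟨conj hDfin ⊓ Formula.iInf fun e => (π e).not,
    (isEqConj_conj hDfin).isQF.inf (isQF_iInf fun e => (hπqf e).not), ?_, ?_⟩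
  · intro M hM b hb
    rw [hq]
    refine ⟨fun e he => ?_, fun e he => hb.2 e.1 e.2 (hπ e M hM b he hb.1)⟩
    rw [← holds_map]
    exact (hD e).2 (.of_mem he) M hM b hb.1
  · intro M hM a ha
    rw [hq] at ha
    let Θ : Set (Eqn L (Fin n)) := {e | Holds a e}
    -- The generic solution: adjoin to the algebra generated by `a` one element subject to `d.pos`.
    -- By the condition on `D` nothing collapses, and by the conditions on `π` no negated equation
    -- is forced.
    obtain ⟨F, hF, g, -, hg⟩ := exists_presented.{u, v, max u v w, 0} hV
      (Eqn.map Fin.castSucc '' Θ ∪ d.pos)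
    have hga : ∀ e : Eqn L (Fin n), Holds (gens L a) e ↔ Holds (g ∘ Fin.castSucc) e := by
      intro e
      rw [holds_gens, ← holds_map, hg]
      constructor
      · exact fun h => .of_mem (.inl ⟨e, h, rfl⟩)
      · intro h
        refine hE.entails_restriction hV (fun e => (hD e).1) h M hM a ?_
        rw [sat_union]
        exact ⟨fun _ h => h, ha.1⟩
    obtain ⟨f, hf⟩ := exists_embedding_of_holds_iff (closure_range_gens a) hga
    obtain ⟨N, h, k, hN, hhk⟩ := hA
      ⟨Substructure.closure L (Set.range a), inferInstance⟩ M F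
      (Substructure.closure L (Set.range a)).subtype f (hV.substructure_mem hM _) hM hF
    refine ⟨N, hN, h, k ∘ g, ?_, (LitSys.sat_embedding k).2 ⟨?_, ?_⟩⟩
    · funext i
      have := DFunLike.congr_fun hhk (gens L a i)
      simp only [Embedding.comp_apply, hf] at this
      exact this.symm
    · exact fun e he => (hg e).2 (.of_mem (.inr he))
    · intro e he hge
      exact ha.2 ⟨e, he⟩ (hπmax ⟨e, he⟩ Θ ((hg e).1 hge) M hM a fun _ h => h)

end Elimination

/-! ### Solving all solvable systems -/

section Closure

variable [L.IsAlgebraic] {V : Set (Bundled.{max u v w} L.Structure)}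

/-- `q` is a quantifier-free condition for the solvability of systems in extensions within `V`. -/
def IsSolvabilityCondition (V : Set (Bundled.{w} L.Structure))
    (q : ∀ n, LitSys L (Fin (n + 1)) → L.Formula (Fin n)) : Prop :=
  ∀ n d, (q n d).IsQF ∧
    (∀ M ∈ V, ∀ b : Fin (n + 1) → M, d.Sat b → (q n d).Realize (b ∘ Fin.castSucc)) ∧
    ∀ M ∈ V, ∀ a : Fin n → M, (q n d).Realize a →
      ∃ N ∈ V, ∃ (f : M ↪[L] N) (b : Fin (n + 1) → N), b ∘ Fin.castSucc = f ∘ a ∧ d.Sat b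

/-- The members of `V` in which every system satisfying the solvability condition is solvable. -/
def solvedClass (V : Set (Bundled.{w} L.Structure))
    (q : ∀ n, LitSys L (Fin (n + 1)) → L.Formula (Fin n)) : Set (Bundled.{w} L.Structure) :=
  {N | N ∈ V ∧ ∀ n d (a : Fin n → N), (q n d).Realize a →
    ∃ b : Fin (n + 1) → N, b ∘ Fin.castSucc = a ∧ d.Sat b}

variable {q : ∀ n, LitSys L (Fin (n + 1)) → L.Formula (Fin n)}

omit [L.IsAlgebraic] in
-- Systems can be solved one after another: conditions and solutions alike are quantifier-free, so
-- they persist under embeddings.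
theorem IsSolvabilityCondition.exists_solving_finset (hq : IsSolvabilityCondition V q)
    {M : Bundled.{max u v w} L.Structure} (hM : M ∈ V)
    (s : Finset (Σ n, LitSys L (Fin (n + 1)) × (Fin n → M)))
    (hs : ∀ r ∈ s, (q r.1 r.2.1).Realize r.2.2) :
    ∃ N ∈ V, ∃ f : M ↪[L] N, ∀ r ∈ s, ∃ b : Fin (r.1 + 1) → N,
      b ∘ Fin.castSucc = f ∘ r.2.2 ∧ r.2.1.Sat b := by
  classical
  induction s using Finset.induction_on with
  | empty => exact ⟨M, hM, Embedding.refl L M, by simp⟩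
  | insert r s _ ih =>
    obtain ⟨N, hN, f, hf⟩ := ih fun r hr => hs r (Finset.mem_insert_of_mem hr)
    obtain ⟨hqf, -, hsolve⟩ := hq r.1 r.2.1
    obtain ⟨N', hN', f', b, hb, hdb⟩ := hsolve N hN (f ∘ r.2.2)
      ((realize_embedding_of_isQF hqf f).2 (hs r (Finset.mem_insert_self _ _)))
    refine ⟨N', hN', f'.comp f, fun r' hr' => ?_⟩
    rcases Finset.mem_insert.1 hr' with rfl | hr'
    · exact ⟨b, hb, hdb⟩
    · obtain ⟨c, hc, hdc⟩ := hf r' hr'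
      exact ⟨f' ∘ c, by rw [Function.comp_assoc, hc]; rfl, (LitSys.sat_embedding f').2 hdc⟩

/-- Compactness applied to the diagram of `M` together with every solvable system over `M`, each
given its own new variable. -/
theorem IsSolvabilityCondition.exists_solving_step [Nonempty L.Constants] (hV : IsVariety V)
    (hq : IsSolvabilityCondition V q)
    {M : Bundled.{max u v w} L.Structure} (hM : M ∈ V) :
    ∃ N ∈ V, ∃ f : M ↪[L] N, ∀ n d (a : Fin n → M), (q n d).Realize a →
      ∃ b : Fin (n + 1) → N, b ∘ Fin.castSucc = f ∘ a ∧ d.Sat b := by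
  classical
  let R := {r : Σ n, LitSys L (Fin (n + 1)) × (Fin n → M) // (q r.1 r.2.1).Realize r.2.2}
  let τ : ∀ r : R, Fin (r.1.1 + 1) → M ⊕ R :=
    fun r => Fin.lastCases (Sum.inr r) fun i => Sum.inl (r.1.2.2 i)
  let Γ : Eqn L M ⊕ R → L.Formula (M ⊕ R) := Sum.elim
    (fun e => (diagramFormula M e).relabel Sum.inl) fun r => r.1.2.1.formula.relabel (τ r)
  obtain ⟨N, a, ha⟩ := exists_realize_of_finset.{u, v, w, max u v w} (T := theoryOf V) Γ (by
    intro s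
    obtain ⟨N, hN, f, hf⟩ := hq.exists_solving_finset hM (s.toRight.image Subtype.val)
      fun r hr => by
        obtain ⟨r, -, rfl⟩ := Finset.mem_image.1 hr
        exact r.2
    have := model_theoryOf hN
    have := nonempty_of_constants (L := L) N
    have hf' : ∀ r : R, ∃ z : N, r ∈ s.toRight → ∃ b : Fin (r.1.1 + 1) → N,
        b ∘ Fin.castSucc = f ∘ r.1.2.2 ∧ b (Fin.last _) = z ∧ r.1.2.1.Sat b := by
      intro r
      by_cases hr : r ∈ s.toRight
      · obtain ⟨b, hb, hdb⟩ := hf r.1 (Finset.mem_image_of_mem _ hr)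
        exact ⟨b (Fin.last _), fun _ => ⟨b, hb, rfl, hdb⟩⟩
      · exact ⟨Classical.arbitrary N, fun h => (hr h).elim⟩
    choose c hc using hf'
    refine ⟨Theory.ModelType.of _ N, Sum.elim f c, ?_⟩
    rintro (e | r) hr
    · simp only [Γ, Sum.elim_inl, Formula.realize_relabel, realize_diagramFormula]
      exact (holds_embedding (a := id) f).symm
    · obtain ⟨b, hb, hbc, hdb⟩ := hc r (by simpa using hr)
      have hτ : (Sum.elim f c : M ⊕ R → N) ∘ τ r = b := by
        funext i
        refine Fin.lastCases ?_ (fun i => ?_) i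
        · simp [τ, hbc]
        · simpa [τ] using (congrFun hb i).symm
      simp only [Γ, Sum.elim_inr, Formula.realize_relabel, LitSys.realize_formula]
      exact hτ ▸ hdb)
  obtain ⟨f, hf⟩ := exists_embedding_of_holds_id (M := M) (b := a ∘ Sum.inl) fun e =>
    realize_diagramFormula.1 (Formula.realize_relabel.1 (ha (.inl e)))
  refine ⟨⟨N, inferInstance⟩, IsVariety.mem_of_model.{u, v, w} hV _ N.is_model, f,
    fun n d c hc => ?_⟩
  have := ha (.inr ⟨⟨n, d, c⟩, hc⟩)
  simp only [Γ, Sum.elim_inr, Formula.realize_relabel, LitSys.realize_formula] at this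
  refine ⟨_, ?_, this⟩
  funext i
  simp [τ, hf]

/-- The limit of an `ω`-chain in which each stage solves the systems over the previous one: a finite
tuple appears at some stage, and its systems are solved at the next. -/
theorem IsSolvabilityCondition.exists_embedding_solvedClass [Nonempty L.Constants]
    (hV : IsVariety V) (hq : IsSolvabilityCondition V q)
    {M : Bundled.{max u v w} L.Structure} (hM : M ∈ V) :
    ∃ N ∈ solvedClass V q, Nonempty (M ↪[L] N) := by
  classical
  choose next hnext step hstep using
    fun M : {M : Bundled.{max u v w} L.Structure // M ∈ V} => hq.exists_solving_step hV M.2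
  let seq : ℕ → {M : Bundled.{max u v w} L.Structure // M ∈ V} :=
    fun k => k.rec ⟨M, hM⟩ fun _ A => ⟨next A, hnext A⟩
  let G : ℕ → Type (max u v w) := fun k => (seq k).1
  let f : ∀ k, G k ↪[L] G (k + 1) := fun k => step (seq k)
  let F := DirectedSystem.natLERec f
  let of : ∀ k, G k ↪[L] Language.DirectLimit G F := DirectLimit.of L ℕ G F
  have hof : ∀ k x, of (k + 1) (f k x) = of k x := by
    intro k x
    have := DirectLimit.of_f (f := F) (hij := Nat.le_succ k) (x := x)
    rw [← this]
    congr 1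
    simp [F, DirectedSystem.coe_natLERec, Nat.leRecOn_succ']
  have hlift : ∀ {n : ℕ} (a : Fin n → Language.DirectLimit G F), ∃ k, ∃ c : Fin n → G k, of k ∘ c = a := by
    intro n a
    obtain ⟨k, c, hc⟩ := DirectLimit.exists_quotient_mk'_sigma_mk'_eq G F a
    exact ⟨k, c, hc.symm⟩
  refine ⟨⟨Language.DirectLimit G F, inferInstance⟩, ⟨?_, ?_⟩, ⟨of 0⟩⟩
  · refine IsVariety.mem_of_holds.{u, v, w} hV _ fun n e he a => ?_
    obtain ⟨k, c, rfl⟩ := hlift a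
    exact (holds_embedding (of k)).2 (he (seq k).1 (seq k).2 c sat_empty)
  · intro n d a ha
    obtain ⟨k, c, rfl⟩ := hlift a
    obtain ⟨b, hb, hdb⟩ := hstep (seq k) n d c
      ((realize_embedding_of_isQF (hq n d).1 (of k)).1 ha)
    refine ⟨of (k + 1) ∘ b, ?_, (LitSys.sat_embedding (of (k + 1))).2 hdb⟩
    rw [Function.comp_assoc, hb]
    funext i
    exact hof k (c i)

end Closure

/-! ### Quantifier elimination -/

section QuantifierElimination

variable [L.IsAlgebraic] {V : Set (Bundled.{max u v w} L.Structure)}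
  {q : ∀ n, LitSys L (Fin (n + 1)) → L.Formula (Fin n)}

/-- Only the quantifier case has content: in the solved class a system has a solution for given
parameters exactly when its condition holds. -/
theorem IsSolvabilityCondition.exists_isQF (hq : IsSolvabilityCondition V q) {m : ℕ}
    (φ : L.BoundedFormula Empty m) : ∃ ψ : L.Formula (Fin m), ψ.IsQF ∧
      ∀ N ∈ solvedClass V q, ∀ (a : Empty → N) (xs : Fin m → N),
        φ.Realize a xs ↔ ψ.Realize xs := by
  induction φ with
  | falsum => exact ⟨⊥, BoundedFormula.isQF_bot, fun _ _ _ _ => Iff.rfl⟩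
  | @equal m t₁ t₂ =>
    let σ : Empty ⊕ Fin m → Fin m := Sum.elim (fun i => i.elim) id
    refine ⟨(t₁.relabel σ).equal (t₂.relabel σ), (BoundedFormula.IsAtomic.equal _ _).isQF,
      fun N _ a xs => ?_⟩
    have : xs ∘ σ = Sum.elim a xs := by
      funext i
      rcases i with i | i
      · exact i.elim
      · rfl
    rw [Formula.realize_equal, Term.realize_relabel, Term.realize_relabel, this]
    rfl
  | rel R => exact isEmptyElim R
  | imp _ _ ih₁ ih₂ =>
    obtain ⟨ψ₁, h₁, h₁'⟩ := ih₁
    obtain ⟨ψ₂, h₂, h₂'⟩ := ih₂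
    refine ⟨ψ₁.imp ψ₂, h₁.imp h₂, fun N hN a xs => ?_⟩
    rw [BoundedFormula.realize_imp, Formula.realize_imp, h₁' N hN, h₂' N hN]
  | @all m φ ih =>
    obtain ⟨ψ, hψ, hφψ⟩ := ih
    -- `∀` is treated as `¬ ∃ ¬`; the existential quantifier distributes over the disjunctive normal
    -- form of `¬ ψ`.
    obtain ⟨D, hD, hDψ⟩ := LitSys.exists_dnf.{u, v, max u v w} hψ.not
    have := hD.to_subtype
    refine ⟨(Formula.iSup fun d : D => q m d).not, (isQF_iSup fun d : D => (hq m d.1).1).not,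
      fun N hN a xs => ?_⟩
    rw [BoundedFormula.realize_all, Formula.realize_not, Formula.realize_iSup,
      ← not_iff_not, not_forall, not_not]
    constructor
    · rintro ⟨z, hz⟩
      rw [hφψ N hN] at hz
      obtain ⟨d, hd, hds⟩ := (hDψ N _).1 hz
      have := (hq m d).2.1 N hN.1 _ hds
      refine ⟨⟨d, hd⟩, ?_⟩
      convert this
      funext i
      simp
    · rintro ⟨⟨d, hd⟩, h⟩
      obtain ⟨b, rfl, hb⟩ := hN.2 m d xs h
      refine ⟨b (Fin.last m), ?_⟩
      rw [hφψ N hN]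
      have hsnoc : (Fin.snoc (b ∘ Fin.castSucc) (b (Fin.last m)) : Fin (m + 1) → N) = b :=
        Fin.snoc_init_self b
      rw [hsnoc]
      exact (hDψ N b).2 ⟨d, hd, hb⟩

theorem IsSolvabilityCondition.exists_isQF_formula (hq : IsSolvabilityCondition V q) {m : ℕ}
    (φ : L.Formula (Fin m)) : ∃ ψ : L.Formula (Fin m), ψ.IsQF ∧
      ∀ N ∈ solvedClass V q, ∀ a : Fin m → N, φ.Realize a ↔ ψ.Realize a := by
  obtain ⟨ψ, hψ, h⟩ := hq.exists_isQF (BoundedFormula.relabel Sum.inr φ)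
  exact ⟨ψ, hψ, fun N hN a => (Formula.realize_relabel_sumInr φ (v := Empty.elim)).symm.trans
    (h N hN _ a)⟩

/-- The solved class is elementary: it is axiomatized over the theory of `V` by the sentences `∀ x,
q → ∃ y, d`. -/
theorem mem_solvedClass_of_model [Nonempty L.Constants] (hV : IsVariety V)
    (N : Bundled.{max u v w} L.Structure) (hN : N ⊨ theoryOf (solvedClass V q)) :
    N ∈ solvedClass V q := by
  have hsub : theoryOf V ⊆ theoryOf (solvedClass V q) := fun φ hφ A hA => hφ A hA.1
  refine ⟨IsVariety.mem_of_model.{u, v, w} hV N (hN.mono hsub), fun n d => ?_⟩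
  obtain ⟨ψ, hψ⟩ := exists_formula_exists_last.{u, v, max u v w} d.formula
  obtain ⟨σ, hσ⟩ := exists_sentence_forall.{u, v, max u v w} ((q n d).imp ψ)
  have h : ∀ A : Bundled.{max u v w} L.Structure, A ⊨ σ ↔
      ∀ a : Fin n → A, (q n d).Realize a →
        ∃ b : Fin (n + 1) → A, b ∘ Fin.castSucc = a ∧ d.Sat b := by
    intro A
    have := nonempty_of_constants (L := L) A
    rw [hσ]
    simp only [Formula.realize_imp, hψ, LitSys.realize_formula]
  exact (h N).1 (hN.realize_of_mem σ fun A hA => (h A).2 (hA.2 n d))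

end QuantifierElimination

/-! ### The model completion -/

/-- Consequence can be tested on models in a larger universe. -/
theorem models_of_realize {T : L.Theory} {α : Type x} {φ : L.Formula α}
    (h : ∀ (N : Theory.ModelType.{u, v, max u v x w} T) (a : α → N), φ.Realize a) : T ⊨ᵇ φ := by
  refine Theory.models_formula_iff.2 fun M a => ?_
  let e : M ≃ ULift.{w} M := Equiv.ulift.symm
  let : L.Structure (ULift.{w} M) := e.inducedStructure
  have : Nonempty (ULift.{w} M) := e.symm.nonempty
  have : ULift.{w} M ⊨ T := StrongHomClass.theory_model (e.inducedStructureEquiv (L := L))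
  exact (StrongHomClass.realize_formula (e.inducedStructureEquiv (L := L)) φ).1
    (h (Theory.ModelType.of T (ULift.{w} M)) (e ∘ a))

theorem exists_formula_fin {α : Type*} (φ : L.Formula α) :
    ∃ (n : ℕ) (ψ : L.Formula (Fin n)) (r : Fin n → α),
      ∀ (M : Type w) [L.Structure M] (a : α → M), φ.Realize a ↔ ψ.Realize (a ∘ r) := by
  classical
  let e := φ.freeVarFinset.equivFin
  refine ⟨_, φ.restrictFreeVar e, fun i => (e.symm i).1, fun M _ a => ?_⟩
  exact (BoundedFormula.realize_restrictFreeVar a fun i => by simp).symm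

variable [L.IsAlgebraic] [Nonempty L.Constants] {V : Set (Bundled.{max u v w} L.Structure)}
  {q : ∀ n, LitSys L (Fin (n + 1)) → L.Formula (Fin n)}

/-- Quantifier elimination gives model completeness, and completeness over diagrams since
quantifier-free facts about elements of `M` are decided in `M`. Embedding members of `V` into the
solved class gives the common universal consequences and consistency with diagrams. -/
theorem IsSolvabilityCondition.isModelCompletion (hV : IsVariety V)
    (hq : IsSolvabilityCondition V q) :
    IsModelCompletion.{u, v, max u v w} (theoryOf V) (theoryOf (solvedClass V q)) := by
  refine ⟨⟨fun n φ => ?_, fun φ hφ => ⟨fun h => ?_, fun h => ?_⟩⟩, fun M _ _ hM => ⟨?_, ?_⟩⟩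
  · obtain ⟨ψ, hψ, hφψ⟩ := hq.exists_isQF_formula φ
    refine ⟨ψ, hψ.isExistential, models_of_realize.{u, v, w, 0} fun N a => ?_⟩
    rw [Formula.realize_iff]
    exact hφψ _ (mem_solvedClass_of_model hV ⟨N, inferInstance⟩ N.is_model) a
  · refine Theory.models_of_models_theory (fun σ hσ => ?_) h
    exact Theory.models_sentence_of_mem fun A hA => hσ A hA.1
  · refine models_of_realize.{u, v, w, 0} fun N a => ?_
    have hN : (⟨N, inferInstance⟩ : Bundled.{max u v w} L.Structure) ∈ V :=
      IsVariety.mem_of_model.{u, v, w} hV _ N.is_model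
    obtain ⟨A, hA, ⟨f⟩⟩ := hq.exists_embedding_solvedClass hV hN
    have := model_theoryOf hA
    have := nonempty_of_constants (L := L) A
    exact hφ.realize_embedding f (h.realize_boundedFormula A)
  · obtain ⟨N, hN, ⟨f⟩⟩ := hq.exists_embedding_solvedClass hV
      (IsVariety.mem_of_model.{u, v, w} hV ⟨M, inferInstance⟩ hM)
    let : (constantsOn M).Structure N := constantsOn.structure f
    have h₁ : N ⊨ diagram L M := model_diagram f
    have := model_theoryOf hN
    have h₂ : N ⊨ (L.lhomWithConstants M).onTheory (theoryOf (solvedClass V q)) :=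
      (LHom.onTheory_model _ _).2 this
    have := nonempty_of_constants (L := L) N
    have := h₂.union h₁
    exact Theory.Model.isSatisfiable N
  · intro φ
    -- Only finitely many constants `r` from `M` occur in `φ`.
    obtain ⟨n, χ, r, hχ⟩ := exists_formula_fin.{u, v, max u v w} (Formula.equivSentence.symm φ)
    obtain ⟨ψ, hψ, hχψ⟩ := hq.exists_isQF_formula χ
    have key : ∀ N : Theory.ModelType ((L.lhomWithConstants M).onTheory
        (theoryOf (solvedClass V q)) ∪ diagram L M), N ⊨ φ ↔ ψ.Realize r := by
      intro N
      have h₁ := N.is_model.mono (Set.subset_union_left (t := diagram L M))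
      have h₂ : N ⊨ diagram L M := N.is_model.mono Set.subset_union_right
      let := (L.lhomWithConstants M).reduct N
      have hN : N ⊨ theoryOf (solvedClass V q) :=
        (LHom.onTheory_model (L.lhomWithConstants M) _).1 h₁
      obtain ⟨f, hf⟩ := exists_embedding_of_model_diagram h₂
      have hcon : (fun m => (L.con m : N)) = f := funext fun m => (hf m).symm
      have := Formula.realize_equivSentence_symm_con N φ
      rw [hcon, hχ, hχψ _ (mem_solvedClass_of_model hV ⟨N, inferInstance⟩ hN)] at this
      exact this.symm.trans (realize_embedding_of_isQF hψ f)
    by_cases h : ψ.Realize r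
    · exact .inl (Theory.models_sentence_iff.2 fun N => (key N).2 h)
    · exact .inr (Theory.models_sentence_iff.2 fun N =>
        (Sentence.realize_not N).2 fun hN => h ((key N).1 hN))

theorem hasModelCompletion (hV : IsVariety V) (hE : HasEDPC V) (hC : Coherent V)
    (hA : Amalgamation V) (hR : EqVarRestriction V) :
    HasModelCompletion.{u, v, max u v w} (theoryOf V) := by
  choose q hq using fun n (d : LitSys L (Fin (n + 1))) =>
    exists_solvability_condition hV hE hC hA hR d
  exact ⟨_, IsSolvabilityCondition.isModelCompletion hV hq⟩

end UnivAlg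

/-! ### The two implications combined -/

theorem theorem4p6 (L : FirstOrder.Language.{u, v}) [L.IsAlgebraic]
    [Nonempty L.Constants]
    (V : Set (CategoryTheory.Bundled.{max u v w} L.Structure)) (hV : UnivAlg.IsVariety V)
    (hEDPC : UnivAlg.HasEDPC V) :
    (UnivAlg.CompactIntersectionProperty V →
      (UnivAlg.HasModelCompletion.{u, v, max u v w} (UnivAlg.theoryOf V) ↔
        UnivAlg.Coherent V ∧ FirstOrder.Language.Amalgamation V ∧
          UnivAlg.EqVarRestriction V)) ∧
    (UnivAlg.Coherent V ∧ FirstOrder.Language.Amalgamation V ∧ UnivAlg.EqVarRestriction V →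
      UnivAlg.HasModelCompletion.{u, v, max u v w} (UnivAlg.theoryOf V)) := by
  have hback : UnivAlg.Coherent V ∧ FirstOrder.Language.Amalgamation V ∧
      UnivAlg.EqVarRestriction V →
      UnivAlg.HasModelCompletion.{u, v, max u v w} (UnivAlg.theoryOf V) :=
    fun ⟨hC, hA, hR⟩ => UnivAlg.hasModelCompletion hV hEDPC hC hA hR
  refine ⟨fun hCIP => ⟨?_, hback⟩, hback⟩
  rintro ⟨T, hT⟩
  exact ⟨hT.coherent hV hEDPC, hT.amalgamation hV, hT.eqVarRestriction hV hCIP⟩
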